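/- Let $G$ be a finite undirected graph without loops (multiple edges are allowed), with $n$ vertices, in which an orientation $t(e)\to h(e)$ of every edge $e$ has been chosen, and let $d\ge 1$ be an integer. For a labeling $\sigma\colon E\to S_d$ of the edge set $E$ of $G$ by permutations of $\{1,\dots,d\}$, let $H_\sigma$ be the $d$-covering of $G$ with vertex set $V(G)\times\{1,\dots,d\}$ that has, for each edge $e$ of $G$ and each $i\in\{1,\dots,d\}$, an edge joining $(h(e),i)$ to $(t(e),\sigma_e(i))$. For a finite graph $H$ with $N$ vertices and with $m_i(H)$ matchings of size $i$, let $\mathcal M_H(x)=\sum_{i=0}^{\lfloor N/2\rfloor}(-1)^i m_i(H)\,x^{N-2i}$ be its matching polynomial. The $d$-matching polynomial of $G$ is the average $$\mathcal M_{d,G}(x)=\frac1{(d!)^{|E|}}\sum_{\sigma\colon E\to S_d}\mathcal M_{H_\sigma}(x).$$ For a connected graph $G$, let $\rho(G)$ be the spectral radius of the universal covering tree $T$ of $G$, i.e. of the adjacency operator $(A_Tf)(v)=\sum_{u\sim v}f(u)$ on $\ell^2(V(T))$. Then $\mathcal M_{d,G}$ is real-rooted. If $G$ is connected, then all roots of $\mathcal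 M_{d,G}$ lie in $[-\rho(G),\rho(G)]$. For a general $G$, every root of $\mathcal M_{d,G}$ lies in $[-\rho(G_i),\rho(G_i)]$ for some connected component $G_i$ of $G$; that is, all roots lie in $[-\rho,\rho]$ with $\rho=\max_i\rho(G_i)$. -/

import Mathlib

open Polynomial

/-- The Hilbert space `ℓ²(W)` of square-summable complex functions on `W`. -/
abbrev EllTwo (W : Type*) : Type _ := lp (fun _ : W => ℂ) 2

/-- In a graph all of whose degrees are at most `D`, the neighbour sums of finitely many vertices
are controlled by the `ℓ²` norm. -/
theorem adjacency_sum_le {W : Type*} (T : SimpleGraph W) [T.LocallyFinite] (D : ℕ)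
    (hD : ∀ w, T.degree w ≤ D) (f : EllTwo W) (s : Finset W) :
    ∑ v ∈ s, ‖∑ u ∈ T.neighborFinset v, f u‖ ^ (2 : ENNReal).toReal
      ≤ ((D : ℝ) * ‖f‖) ^ (2 : ENNReal).toReal := by
  classical
  have h2 : (2 : ENNReal).toReal = ((2 : ℕ) : ℝ) := by norm_num
  have hf : ∀ t : Finset W, ∑ u ∈ t, ‖f u‖ ^ 2 ≤ ‖f‖ ^ 2 := by
    intro t
    have h := lp.sum_rpow_le_norm_rpow (p := 2) (by norm_num) f t
    simpa only [h2, Real.rpow_natCast] using h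
  simp only [h2, Real.rpow_natCast]
  have h1 : ∀ v, ‖∑ u ∈ T.neighborFinset v, f u‖ ^ 2
      ≤ (D : ℝ) * ∑ u ∈ T.neighborFinset v, ‖f u‖ ^ 2 := by
    intro v
    calc ‖∑ u ∈ T.neighborFinset v, f u‖ ^ 2
        ≤ (∑ u ∈ T.neighborFinset v, ‖f u‖) ^ 2 := by
          gcongr
          exact norm_sum_le _ _
      _ ≤ ((T.neighborFinset v).card : ℝ) * ∑ u ∈ T.neighborFinset v, ‖f u‖ ^ 2 :=
          sq_sum_le_card_mul_sum_sq
      _ ≤ (D : ℝ) * ∑ u ∈ T.neighborFinset v, ‖f u‖ ^ 2 := by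
          gcongr
          exact hD v
  have h3 : ∑ v ∈ s, ∑ u ∈ T.neighborFinset v, ‖f u‖ ^ 2
      ≤ (D : ℝ) * ∑ u ∈ s.biUnion (fun v => T.neighborFinset v), ‖f u‖ ^ 2 := by
    rw [Finset.sum_comm' (t' := s.biUnion (fun v => T.neighborFinset v))
      (s' := fun u => s.filter (fun v => T.Adj v u)), Finset.mul_sum]
    · refine Finset.sum_le_sum fun u _ => ?_
      rw [Finset.sum_const, nsmul_eq_mul]
      gcongr
      refine le_trans (Finset.card_le_card ?_) (hD u)
      intro v hv
      simp only [Finset.mem_filter] at hv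
      simpa using hv.2.symm
    · intro v u
      simp only [Finset.mem_filter, Finset.mem_biUnion, SimpleGraph.mem_neighborFinset]
      constructor
      · rintro ⟨hv, huv⟩
        exact ⟨⟨hv, huv⟩, v, hv, huv⟩
      · rintro ⟨⟨hv, huv⟩, -⟩
        exact ⟨hv, huv⟩
  calc ∑ v ∈ s, ‖∑ u ∈ T.neighborFinset v, f u‖ ^ 2
      ≤ ∑ v ∈ s, (D : ℝ) * ∑ u ∈ T.neighborFinset v, ‖f u‖ ^ 2 :=
        Finset.sum_le_sum fun v _ => h1 v
    _ = (D : ℝ) * ∑ v ∈ s, ∑ u ∈ T.neighborFinset v, ‖f u‖ ^ 2 := by rw [Finset.mul_sum]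
    _ ≤ (D : ℝ) * ((D : ℝ) * ‖f‖ ^ 2) := by
        gcongr
        refine h3.trans ?_
        gcongr
        exact hf _
    _ = ((D : ℝ) * ‖f‖) ^ 2 := by ring

/-- The adjacency operator `(A f) v = ∑_{u ∼ v} f u` on `ℓ²(W)` of a graph on `W` with
bounded degrees, as a bounded operator. -/
noncomputable def adjacencyOperator {W : Type*} (T : SimpleGraph W) [T.LocallyFinite] (D : ℕ)
    (hD : ∀ w, T.degree w ≤ D) : EllTwo W →L[ℂ] EllTwo W :=
  LinearMap.mkContinuous
    { toFun := fun f => ⟨fun v => ∑ u ∈ T.neighborFinset v, f u,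
        memℓp_gen' (adjacency_sum_le T D hD f)⟩
      map_add' := fun f g => by
        ext v
        exact Finset.sum_add_distrib
      map_smul' := fun c f => by
        ext v
        simp [Finset.mul_sum] }
    (D : ℝ)
    (fun f => lp.norm_le_of_forall_sum_le (by norm_num) (by positivity)
      (adjacency_sum_le T D hD f))

/-- An undirected graph with vertex set `V` in which an orientation of every edge has been chosen;
`E` is the set of the (chosen, positively oriented) edges.  Multiple edges and loops are
allowed. -/
structure OrientedGraph (V E : Type*) where
  head : E → V
  tail : E → V

namespace OrientedGraph

variable {V E : Type*}

/-- No edge joins a vertex to itself. -/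
def Loopless (G : OrientedGraph V E) : Prop :=
  ∀ e, G.head e ≠ G.tail e

/-- Connectedness of the undirected graph: the simple graph that joins two distinct vertices
when some edge has them as its endpoints is connected (so that `V` is nonempty). -/
def Connected (G : OrientedGraph V E) : Prop :=
  (SimpleGraph.fromRel (fun u v => ∃ e, G.head e = u ∧ G.tail e = v)).Connected

/-- A matching: a finite set of non-loop edges, no two of which share an endpoint. -/
def IsMatching (G : OrientedGraph V E) (M : Finset E) : Prop :=
  (∀ e ∈ M, G.head e ≠ G.tail e) ∧
    ∀ e ∈ M, ∀ f ∈ M, e ≠ f →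
      G.head e ≠ G.head f ∧ G.head e ≠ G.tail f ∧ G.tail e ≠ G.head f ∧ G.tail e ≠ G.tail f

open Classical in
/-- The number of matchings with `i` edges. -/
noncomputable def numMatchings [Fintype E] (G : OrientedGraph V E) (i : ℕ) : ℕ :=
  (Finset.univ.filter (fun M : Finset E => G.IsMatching M ∧ M.card = i)).card

/-- The matching polynomial `∑_{i ≤ n/2} (-1)^i m_i x^(n-2i)`, where `n` is the number of
vertices and `m_i` the number of matchings with `i` edges. -/
noncomputable def matchingPoly [Fintype V] [Fintype E] (G : OrientedGraph V E) : ℝ[X] :=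
  ∑ i ∈ Finset.range (Fintype.card V / 2 + 1),
    C ((-1) ^ i * (G.numMatchings i : ℝ)) * X ^ (Fintype.card V - 2 * i)

/-- The `d`-covering given by a labeling `σ` of the edges by permutations of `d` points:
its vertices are the pairs `(v, i)`, and for each edge `e` and each `i` it has an edge joining
`(head e, i)` to `(tail e, σ e i)`. -/
def covering (G : OrientedGraph V E) (d : ℕ) (σ : E → Equiv.Perm (Fin d)) :
    OrientedGraph (V × Fin d) (E × Fin d) where
  head := fun p => (G.head p.1, p.2)
  tail := fun p => (G.tail p.1, σ p.1 p.2)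

open Classical in
/-- The `d`-matching polynomial: the average of the matching polynomials of the `d`-coverings,
over all labelings of the edges by permutations of `d` points. -/
noncomputable def dMatchingPoly [Fintype V] [Fintype E] (G : OrientedGraph V E) (d : ℕ) : ℝ[X] :=
  C ((Fintype.card (E → Equiv.Perm (Fin d)) : ℝ)⁻¹) *
    ∑ σ : E → Equiv.Perm (Fin d), (G.covering d σ).matchingPoly

/-- Each edge gives two oriented edges: `(e, true)` is `e` with its chosen orientation,
`(e, false)` is `e` with the opposite one. -/
abbrev Dart (_G : OrientedGraph V E) : Type _ := E × Bool

/-- The oriented edge `-e`. -/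
def rev (G : OrientedGraph V E) (e : G.Dart) : G.Dart := (e.1, !e.2)

/-- The vertex at which an oriented edge starts. -/
def source (G : OrientedGraph V E) (e : G.Dart) : V := if e.2 then G.tail e.1 else G.head e.1

/-- The vertex at which an oriented edge ends. -/
def target (G : OrientedGraph V E) (e : G.Dart) : V := if e.2 then G.head e.1 else G.tail e.1

/-- The vertex reached from `v` by the walk `l`; walks are written with their last step first. -/
def endpoint (G : OrientedGraph V E) (v : V) : List G.Dart → V
  | [] => v
  | e :: _ => G.target e

/-- `l` is a non-backtracking walk in `G` that starts at `v` (last step first): consecutive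
oriented edges fit together, and no step is the reversal of the one before it. -/
def IsReducedWalk (G : OrientedGraph V E) (v : V) : List G.Dart → Prop
  | [] => True
  | e :: l => G.IsReducedWalk v l ∧ G.source e = G.endpoint v l ∧ l.head? ≠ some (G.rev e)

/-- The vertices of the universal covering tree of the component of `v`. -/
abbrev UniversalCoverVertex (G : OrientedGraph V E) (v : V) : Type _ :=
  {l : List G.Dart // G.IsReducedWalk v l}

/-- The universal covering tree of the connected component of `v`, based at `v`: its vertices are
the non-backtracking walks from `v`, two of them being adjacent when one extends the other
by a single step. -/
def universalCover (G : OrientedGraph V E) (v : V) : SimpleGraph (G.UniversalCoverVertex v) :=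
  SimpleGraph.fromRel (fun l l' => ∃ e : G.Dart, l'.1 = e :: l.1)

theorem universalCover_neighborSet_subset (G : OrientedGraph V E) (v : V)
    (l : G.UniversalCoverVertex v) :
    Subtype.val '' (G.universalCover v).neighborSet l
      ⊆ insert l.1.tail (Set.range (fun e : G.Dart => e :: l.1)) := by
  rintro _ ⟨l', hl', rfl⟩
  simp only [SimpleGraph.mem_neighborSet, universalCover, SimpleGraph.fromRel_adj] at hl'
  obtain ⟨-, ⟨e, he⟩ | ⟨e, he⟩⟩ := hl'
  · exact Or.inr ⟨e, he.symm⟩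
  · exact Or.inl (by rw [he, List.tail_cons])

theorem universalCover_neighborSet_finite [Fintype E] (G : OrientedGraph V E) (v : V)
    (l : G.UniversalCoverVertex v) : ((G.universalCover v).neighborSet l).Finite :=
  Set.Finite.of_finite_image
    (((Set.finite_range _).insert _).subset (G.universalCover_neighborSet_subset v l))
    Subtype.val_injective.injOn

noncomputable instance [Fintype E] (G : OrientedGraph V E) (v : V) :
    (G.universalCover v).LocallyFinite :=
  fun l => (G.universalCover_neighborSet_finite v l).fintype

theorem universalCover_degree_le [Fintype E] (G : OrientedGraph V E) (v : V)
    (l : G.UniversalCoverVertex v) :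
    (G.universalCover v).degree l ≤ Fintype.card G.Dart + 1 := by
  classical
  have hs : ((Set.univ : Set G.Dart).image (fun e : G.Dart => e :: l.1)).ncard
      ≤ Fintype.card G.Dart := by
    refine (Set.ncard_image_le (Set.toFinite _)).trans ?_
    rw [Set.ncard_univ, Nat.card_eq_fintype_card]
  rw [Set.image_univ] at hs
  calc (G.universalCover v).degree l
      = ((G.universalCover v).neighborSet l).ncard := by
        rw [← SimpleGraph.card_neighborSet_eq_degree, ← Nat.card_eq_fintype_card,
          Nat.card_coe_set_eq]
    _ = (Subtype.val '' (G.universalCover v).neighborSet l).ncard :=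
        (Set.ncard_image_of_injective _ Subtype.val_injective).symm
    _ ≤ (insert l.1.tail (Set.range (fun e : G.Dart => e :: l.1))).ncard :=
        Set.ncard_le_ncard (G.universalCover_neighborSet_subset v l)
          ((Set.finite_range _).insert _)
    _ ≤ (Set.range (fun e : G.Dart => e :: l.1)).ncard + 1 := Set.ncard_insert_le _ _
    _ ≤ Fintype.card G.Dart + 1 := by gcongr

/-- `ρ`: the spectral radius of the universal covering tree of the connected component of `v`,
that is, of its adjacency operator on `ℓ²`.  For a connected graph the tree, and hence this
number, does not depend on the base point `v` up to isomorphism, and is written `ρ(G)`. -/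
noncomputable def rho [Fintype E] (G : OrientedGraph V E) (v : V) : ℝ :=
  (spectralRadius ℂ (adjacencyOperator (G.universalCover v) (Fintype.card G.Dart + 1)
    (G.universalCover_degree_le v))).toReal

end OrientedGraph

/-! Both assertions are proved for multivariate matching polynomials `matchingSum`, which satisfy
recursions over edges and over vertices.

Real-rootedness: summed over all labelings, these polynomials do not vanish when every variable lies
in the open upper half-plane (`coveringMatchingSum_ne_zero`). The edges of `G` are added one at a
time. The lifts of an edge `e` act through commuting operators `1 - ∂∂'`, one for each `i`, in the
variables of `(head e, i)` and `(tail e, σ e i)`. Introducing auxiliary shifts of these variables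
turns the sum over `σ e` into a symmetrization of the shifts on the tail fibre. Symmetrization
preserves nonvanishing for multiaffine functions (`IsMultiaffine.sum_perm_ne_zero`), and so does
each operator (`sub_ne_zero_of_biaffine_ne_zero`). Equating all variables excludes nonreal roots.

Root bound: no averaging is needed, since each covering already has a positive matching polynomial
at every `lam > ρ`. The resolvent of the tree's adjacency operator yields a positive strictly
superharmonic function, and the vertex recursion compares ratios of matching sums with ratios of
this function along reduced walks (`matchingSum_covering_pos`). Parity handles negative arguments.
-/

namespace OrientedGraph

/-! ### Multivariate matching polynomials and their recursions. -/

section MatchingSum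

variable {V E R : Type*} [DecidableEq V] [DecidableEq E] [CommRing R]

/-- The set of vertices covered by a set of edges. -/
def cover (G : OrientedGraph V E) (M : Finset E) : Finset V :=
  M.image G.head ∪ M.image G.tail

open Classical in
/-- The signed sum over the matchings with edges in `A` and endpoints in `S`, each of them weighted
by the product of the variables of the uncovered vertices of `S`. -/
noncomputable def matchingSum (G : OrientedGraph V E) (A : Finset E) (S : Finset V) (x : V → R) :
    R :=
  ∑ M ∈ A.powerset with G.IsMatching M ∧ ∀ e ∈ M, G.head e ∈ S ∧ G.tail e ∈ S,
    (-1) ^ M.card * ∏ w ∈ S \ G.cover M, x w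

omit [DecidableEq V] [DecidableEq E] in
theorem isMatching_empty (G : OrientedGraph V E) : G.IsMatching ∅ := by
  simp [IsMatching]

omit [DecidableEq E] in
theorem matchingSum_empty (G : OrientedGraph V E) (S : Finset V) (x : V → R) :
    G.matchingSum ∅ S x = ∏ w ∈ S, x w := by
  classical
  rw [matchingSum, Finset.sum_filter]
  simp [isMatching_empty, cover]

theorem isMatching_insert_iff (G : OrientedGraph V E) {e : E} {M : Finset E} (he : e ∉ M)
    (S : Finset V) :
    (G.IsMatching (insert e M) ∧ ∀ f ∈ insert e M, G.head f ∈ S ∧ G.tail f ∈ S) ↔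
      (G.head e ≠ G.tail e ∧ G.head e ∈ S ∧ G.tail e ∈ S) ∧ G.IsMatching M ∧
        ∀ f ∈ M, G.head f ∈ (S.erase (G.head e)).erase (G.tail e) ∧
          G.tail f ∈ (S.erase (G.head e)).erase (G.tail e) := by
  have hne : ∀ f ∈ M, e ≠ f := fun f hf h => he (h ▸ hf)
  simp only [IsMatching, Finset.mem_insert, Finset.mem_erase, forall_eq_or_imp]
  constructor
  · rintro ⟨⟨⟨h1, h2⟩, ⟨-, h3⟩, h4⟩, ⟨h5, h6⟩⟩
    refine ⟨⟨h1, h5.1, h5.2⟩, ⟨h2, fun f hf => (h4 f hf).2⟩, fun f hf => ?_⟩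
    have := h3 f hf (hne f hf)
    exact ⟨⟨this.2.2.1.symm, this.1.symm, (h6 f hf).1⟩, this.2.2.2.symm, this.2.1.symm,
      (h6 f hf).2⟩
  · rintro ⟨⟨h1, h2, h3⟩, ⟨h4, h5⟩, h6⟩
    refine ⟨⟨⟨h1, h4⟩, ⟨fun h => absurd rfl h, fun f hf _ => ?_⟩, fun f hf => ⟨fun _ => ?_, h5 f hf⟩⟩,
      ⟨h2, h3⟩, fun f hf => ⟨(h6 f hf).1.2.2, (h6 f hf).2.2.2⟩⟩
    · have := h6 f hf
      exact ⟨this.1.2.1.symm, this.2.2.1.symm, this.1.1.symm, this.2.1.symm⟩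
    · have := h6 f hf
      exact ⟨this.1.2.1, this.1.1, this.2.2.1, this.2.1⟩

/-- A matching either omits `e`, or uses it and is otherwise a matching avoiding both its ends. The
extra edge costs a sign. -/
theorem matchingSum_insert (G : OrientedGraph V E) {e : E} {A : Finset E} (he : e ∉ A)
    (hl : G.head e ≠ G.tail e) (S : Finset V) (x : V → R) :
    G.matchingSum (insert e A) S x = G.matchingSum A S x -
      if G.head e ∈ S ∧ G.tail e ∈ S then
        G.matchingSum A ((S.erase (G.head e)).erase (G.tail e)) x else 0 := by
  classical
  simp only [matchingSum, Finset.sum_filter]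
  rw [Finset.sum_powerset_insert he, sub_eq_add_neg]
  congr 1
  have key : ∀ M ∈ A.powerset,
      (if G.IsMatching (insert e M) ∧ ∀ f ∈ insert e M, G.head f ∈ S ∧ G.tail f ∈ S then
        (-1) ^ (insert e M).card * ∏ w ∈ S \ G.cover (insert e M), x w else 0) =
      -(if G.head e ∈ S ∧ G.tail e ∈ S then
        (if G.IsMatching M ∧ ∀ f ∈ M, G.head f ∈ (S.erase (G.head e)).erase (G.tail e) ∧
          G.tail f ∈ (S.erase (G.head e)).erase (G.tail e) then
        (-1) ^ M.card * ∏ w ∈ (S.erase (G.head e)).erase (G.tail e) \ G.cover M, x w else 0)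
        else 0) := by
    intro M hM
    have heM : e ∉ M := fun h => he (Finset.mem_powerset.1 hM h)
    have hset : S \ G.cover (insert e M) =
        (S.erase (G.head e)).erase (G.tail e) \ G.cover M := by
      ext w
      simp only [cover, Finset.mem_sdiff, Finset.mem_union, Finset.mem_image, Finset.mem_insert,
        Finset.mem_erase]
      grind
    rw [hset, Finset.card_insert_of_notMem heM]
    simp only [G.isMatching_insert_iff heM S]
    by_cases h1 : G.head e ∈ S ∧ G.tail e ∈ S
    · by_cases h2 : G.IsMatching M ∧ ∀ f ∈ M, G.head f ∈ (S.erase (G.head e)).erase (G.tail e) ∧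
          G.tail f ∈ (S.erase (G.head e)).erase (G.tail e)
      · rw [if_pos ⟨⟨hl, h1⟩, h2⟩, if_pos h1, if_pos h2]; ring
      · rw [if_neg (fun h => h2 h.2), if_pos h1, if_neg h2, neg_zero]
    · rw [if_neg (fun h => h1 h.1.2), if_neg h1, neg_zero]
  rw [Finset.sum_congr rfl key, Finset.sum_neg_distrib]
  split_ifs <;> simp

omit [DecidableEq E] in
theorem matchingSum_congr (G : OrientedGraph V E) (A : Finset E) {S : Finset V} {x y : V → R}
    (h : ∀ w ∈ S, x w = y w) : G.matchingSum A S x = G.matchingSum A S y := by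
  classical
  unfold matchingSum
  refine Finset.sum_congr rfl fun M _ => ?_
  congr 1
  exact Finset.prod_congr rfl fun w hw => h w (Finset.mem_sdiff.1 hw).1

/-- Setting `x w` to zero keeps exactly the matchings covering `w`; the others are the matchings
inside `S.erase w`. In particular the sum is affine in each variable. -/
theorem matchingSum_eq_add (G : OrientedGraph V E) (hG : G.Loopless) (A : Finset E) (S : Finset V)
    {w : V} (hw : w ∈ S) (x : V → R) :
    G.matchingSum A S x =
      G.matchingSum A S (Function.update x w 0) + x w * G.matchingSum A (S.erase w) x := by
  induction A using Finset.induction_on generalizing S with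
  | empty =>
    simp only [matchingSum_empty]
    rw [← Finset.mul_prod_erase _ _ hw,
      Finset.prod_eq_zero hw (by simp : Function.update x w 0 w = 0), zero_add]
  | insert e A he ih =>
    simp only [matchingSum_insert G he (hG e)]
    rw [ih S hw]
    by_cases h1 : G.head e ∈ S ∧ G.tail e ∈ S
    · by_cases h2 : w = G.head e ∨ w = G.tail e
      · have h3 : ¬ (G.head e ∈ S.erase w ∧ G.tail e ∈ S.erase w) := by
          rcases h2 with rfl | rfl <;> simp
        rw [if_pos h1, if_pos h1, if_neg h3]
        have : G.matchingSum A ((S.erase (G.head e)).erase (G.tail e)) (Function.update x w 0) =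
            G.matchingSum A ((S.erase (G.head e)).erase (G.tail e)) x := by
          refine G.matchingSum_congr A fun u hu => Function.update_of_ne ?_ _ _
          simp only [Finset.mem_erase] at hu
          grind
        rw [this]; ring
      · push Not at h2
        have h3 : (G.head e ∈ S.erase w ∧ G.tail e ∈ S.erase w) :=
          ⟨Finset.mem_erase.2 ⟨h2.1.symm, h1.1⟩, Finset.mem_erase.2 ⟨h2.2.symm, h1.2⟩⟩
        rw [if_pos h1, if_pos h1, if_pos h3,
          ih ((S.erase (G.head e)).erase (G.tail e)) (by simp [h2, hw])]
        have : (((S.erase (G.head e)).erase (G.tail e)).erase w) =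
            (((S.erase w).erase (G.head e)).erase (G.tail e)) := by
          ext u; simp only [Finset.mem_erase]; tauto
        rw [this]; ring
    · have h3 : ¬ (G.head e ∈ S.erase w ∧ G.tail e ∈ S.erase w) := fun h =>
        h1 ⟨Finset.mem_of_mem_erase h.1, Finset.mem_of_mem_erase h.2⟩
      rw [if_neg h1, if_neg h1, if_neg h3]; ring


/-- Expansion of the matching sum at a vertex, over the edges at that vertex. -/
theorem matchingSum_eq_sub_sum (G : OrientedGraph V E) (hG : G.Loopless) (A : Finset E)
    (S : Finset V) {w : V} (hw : w ∈ S) (x : V → R) :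
    G.matchingSum A S x = x w * G.matchingSum A (S.erase w) x -
      ∑ f ∈ A, ((if G.tail f = w ∧ G.head f ∈ S then
          G.matchingSum A ((S.erase w).erase (G.head f)) x else 0) +
        if G.head f = w ∧ G.tail f ∈ S then
          G.matchingSum A ((S.erase w).erase (G.tail f)) x else 0) := by
  induction A using Finset.induction_on generalizing S with
  | empty => simp [matchingSum_empty, Finset.mul_prod_erase _ _ hw]
  | insert e A he ih =>
    have hle := hG e
    rw [Finset.sum_insert he]
    simp only [matchingSum_insert G he (hG e)]
    by_cases h1 : G.head e ∈ S ∧ G.tail e ∈ S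
    · by_cases h2 : G.head e ≠ w ∧ G.tail e ≠ w
      · have hw' : w ∈ (S.erase (G.head e)).erase (G.tail e) := by
          simp [h2.1.symm, h2.2.symm, hw]
        have hn1 : ¬ (G.tail e = w ∧ G.head e ∈ S) := fun h => h2.2 h.1
        have hn2 : ¬ (G.head e = w ∧ G.tail e ∈ S) := fun h => h2.1 h.1
        have hp : G.head e ∈ S.erase w ∧ G.tail e ∈ S.erase w :=
          ⟨Finset.mem_erase.2 ⟨h2.1, h1.1⟩, Finset.mem_erase.2 ⟨h2.2, h1.2⟩⟩
        rw [if_pos h1, ih S hw, ih _ hw', if_neg hn1, if_neg hn2, if_pos hp]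
        have hc : ((S.erase (G.head e)).erase (G.tail e)).erase w =
            ((S.erase w).erase (G.head e)).erase (G.tail e) := by
          ext u; simp only [Finset.mem_erase]; tauto
        rw [hc, add_zero, zero_add, mul_sub]
        suffices h : ∀ f ∈ A, _ from by
          rw [sub_sub_sub_comm, ← Finset.sum_sub_distrib]
          congr 1
          exact Finset.sum_congr rfl h
        intro f _
        have hcu : ∀ u, (((S.erase w).erase (G.head e)).erase (G.tail e)).erase u =
            (((S.erase w).erase u).erase (G.head e)).erase (G.tail e) := fun u => by
          ext; simp only [Finset.mem_erase]; tauto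
        simp only [hcu, Finset.mem_erase]
        split_ifs <;> first | ring1 | (exfalso; grind)
      · have hn : ∀ B : Finset V, B ⊆ S.erase w → ¬ (G.head e ∈ B ∧ G.tail e ∈ B) := by
          intro B hB h
          have ha := hB h.1
          have hb := hB h.2
          simp only [Finset.mem_erase] at ha hb
          tauto
        rw [if_pos h1, ih S hw]
        simp only [if_neg (hn _ subset_rfl), if_neg (hn _ (Finset.erase_subset _ _)), sub_zero]
        rw [sub_sub, add_comm (∑ f ∈ A, _)]
        congr 2
        by_cases h3 : G.head e = w
        · subst h3
          rw [if_neg (fun h => hle h.1.symm), if_pos ⟨rfl, h1.2⟩, zero_add]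
        · have h4 : G.tail e = w := by tauto
          subst h4
          rw [if_pos ⟨rfl, h1.1⟩, if_neg (fun h => h3 h.1), add_zero, Finset.erase_right_comm]
    · have hn : ∀ B : Finset V, B ⊆ S → ¬ (G.head e ∈ B ∧ G.tail e ∈ B) := fun B hB h =>
        h1 ⟨hB h.1, hB h.2⟩
      have hs := Finset.erase_subset w S
      simp only [if_neg h1, if_neg (hn _ hs),
        if_neg (hn _ ((Finset.erase_subset _ _).trans hs)), sub_zero]
      have hn1 : ¬ (G.tail e = w ∧ G.head e ∈ S) := fun h => h1 ⟨h.2, h.1 ▸ hw⟩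
      have hn2 : ¬ (G.head e = w ∧ G.tail e ∈ S) := fun h => h1 ⟨h.1 ▸ hw, h.2⟩
      rw [if_neg hn1, if_neg hn2, zero_add, zero_add]
      exact ih S hw

theorem card_cover (G : OrientedGraph V E) {M : Finset E} (hM : G.IsMatching M) :
    (G.cover M).card = 2 * M.card := by
  rw [cover, Finset.card_union_of_disjoint, Finset.card_image_of_injOn,
    Finset.card_image_of_injOn, two_mul]
  · intro e he f hf h
    by_contra hne
    exact (hM.2 e he f hf hne).2.2.2 h
  · intro e he f hf h
    by_contra hne
    exact (hM.2 e he f hf hne).1 h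
  · rw [Finset.disjoint_left]
    intro v hv hv'
    obtain ⟨e, he, rfl⟩ := Finset.mem_image.1 hv
    obtain ⟨f, hf, h⟩ := Finset.mem_image.1 hv'
    by_cases hne : e = f
    · subst hne; exact hM.1 e he h.symm
    · exact (hM.2 e he f hf hne).2.1 h.symm

theorem aeval_matchingPoly [Fintype V] [Fintype E] [Algebra ℝ R] (G : OrientedGraph V E) (z : R) :
    aeval z G.matchingPoly = G.matchingSum Finset.univ Finset.univ (fun _ => z) := by
  classical
  have hcard : ∀ M : Finset E, G.IsMatching M →
      (Finset.univ \ G.cover M).card = Fintype.card V - 2 * M.card := fun M hM => by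
    rw [Finset.card_sdiff_of_subset (Finset.subset_univ _), G.card_cover hM, Finset.card_univ]
  have hle : ∀ M : Finset E, G.IsMatching M → M.card ∈ Finset.range (Fintype.card V / 2 + 1) := by
    intro M hM
    have := (G.card_cover hM).symm.trans_le (Finset.card_le_univ _)
    rw [Finset.mem_range]
    omega
  have hS : G.matchingSum Finset.univ Finset.univ (fun _ => z) =
      ∑ M : Finset E with G.IsMatching M,
        (-1) ^ M.card * z ^ (Fintype.card V - 2 * M.card) := by
    rw [matchingSum]
    simp only [Finset.powerset_univ, Finset.mem_univ, and_self, implies_true, and_true,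
      Finset.prod_const]
    refine Finset.sum_congr (by ext; simp) fun M hM => ?_
    rw [hcard M (by simpa using hM)]
  rw [hS, ← Finset.sum_fiberwise_of_maps_to (t := Finset.range (Fintype.card V / 2 + 1))
    (g := Finset.card) (fun M hM => hle M (by simpa using hM)), matchingPoly, map_sum]
  refine Finset.sum_congr rfl fun i _ => ?_
  rw [Finset.filter_filter, Finset.sum_congr rfl
    (g := fun _ => (-1) ^ i * z ^ (Fintype.card V - 2 * i))
    (fun M hM => by rw [(Finset.mem_filter.1 hM).2.2]), Finset.sum_const, numMatchings]
  simp only [map_mul, aeval_X, map_pow, map_neg, map_one, map_natCast, nsmul_eq_mul]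
  ring_nf

end MatchingSum

end OrientedGraph

/-! ### Superharmonic functions from the resolvent. -/

/-- Gelfand's formula bounds `‖a ^ n‖` by `r ^ n` eventually, for any `r` strictly between the
spectral radius and `μ`. -/
theorem summable_pow_of_spectralRadius_lt {A : Type*} [NormedRing A] [NormedAlgebra ℂ A]
    [CompleteSpace A] (a : A) {μ : ℝ} (h : spectralRadius ℂ a < ENNReal.ofReal μ) :
    Summable fun n : ℕ => ((μ : ℂ)⁻¹ • a) ^ n := by
  obtain ⟨r, hr1, hr2⟩ := exists_between h
  lift r to NNReal using ne_top_of_lt hr2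
  have hμ : 0 < μ := ENNReal.ofReal_pos.1 (lt_of_le_of_lt zero_le h)
  have hrμ : (r : ℝ) < μ := by
    rw [ENNReal.ofReal, ENNReal.coe_lt_coe] at hr2
    simpa [Real.coe_toNNReal _ hμ.le] using NNReal.coe_lt_coe.2 hr2
  have hq : Summable fun n : ℕ => ((r : ℝ) / μ) ^ n :=
    summable_geometric_of_lt_one (by positivity) ((div_lt_one hμ).2 hrμ)
  refine Summable.of_norm_bounded_eventually_nat hq ?_
  have hev := (spectrum.pow_nnnorm_pow_one_div_tendsto_nhds_spectralRadius a).eventually_lt_const hr1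
  filter_upwards [hev, Filter.eventually_gt_atTop 0] with n hn hn0
  have hn' : (‖a ^ n‖₊ : ENNReal) ≤ (r : ENNReal) ^ n := by
    have := ENNReal.rpow_le_rpow hn.le (z := (n : ℝ)) (by positivity)
    rwa [← ENNReal.rpow_mul, one_div, inv_mul_cancel₀ (by positivity), ENNReal.rpow_one,
      ENNReal.rpow_natCast] at this
  have hn2 : ‖a ^ n‖ ≤ (r : ℝ) ^ n := by exact_mod_cast hn'
  rw [_root_.smul_pow, norm_smul, norm_pow, norm_inv, Complex.norm_real, Real.norm_of_nonneg hμ.le, div_pow,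
    inv_pow, inv_mul_eq_div]
  gcongr

/-- Take `g = ∑ (A/μ)^n δ_o`. Its terms have nonnegative real entries, and `g = δ_o + μ⁻¹ A g`. -/
theorem exists_nonneg_superharmonic {W : Type*} (T : SimpleGraph W) [T.LocallyFinite] (D : ℕ)
    (hD : ∀ w, T.degree w ≤ D) (o : W) {μ : ℝ}
    (hμ : (spectralRadius ℂ (adjacencyOperator T D hD)).toReal < μ) :
    ∃ g : W → ℝ, (∀ w, 0 ≤ g w) ∧ 0 < g o ∧ ∀ w, ∑ u ∈ T.neighborFinset w, g u ≤ μ * g w := by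
  classical
  set A := adjacencyOperator T D hD with hA
  have hμ0 : 0 < μ := lt_of_le_of_lt ENNReal.toReal_nonneg hμ
  -- Nontriviality gives the identity operator norm one, so the spectral radius is at most `‖A‖`. It
  -- is thus finite, and `toReal` in `hμ` does not collapse `⊤` to `0`.
  have : Nontrivial (EllTwo W) := by
    refine ⟨lp.single 2 o 1, 0, fun h => ?_⟩
    have := congrArg (fun f : EllTwo W => f o) h
    simp at this
  have hfin : spectralRadius ℂ A ≠ ⊤ :=
    ne_top_of_le_ne_top ENNReal.coe_ne_top (spectrum.spectralRadius_le_nnnorm A)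
  have hlt : spectralRadius ℂ A < ENNReal.ofReal μ :=
    (ENNReal.lt_ofReal_iff_toReal_lt hfin).2 hμ
  have hs := summable_pow_of_spectralRadius_lt A hlt
  set B := (μ : ℂ)⁻¹ • A with hB
  set S := ∑' n, B ^ n with hS
  have hS1 : S = 1 + B * S := by
    rw [hS, ← hs.tsum_mul_left]
    conv_lhs => rw [hs.tsum_eq_zero_add, pow_zero]
    simp only [pow_succ']
  set δ : EllTwo W := lp.single 2 o 1 with hδ
  have hu : ∀ w, (S δ) w = δ w + (μ : ℂ)⁻¹ * ∑ u ∈ T.neighborFinset w, (S δ) u := fun w => by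
    conv_lhs => rw [hS1]
    rfl
  have hev : ∀ w, HasSum (fun n => ((B ^ n) δ) w) ((S δ) w) := fun w => by
    have h1 : HasSum (fun n => (B ^ n) δ) (S δ) :=
      hs.hasSum.mapL (ContinuousLinearMap.apply ℂ (EllTwo W) δ)
    exact h1.mapL (lp.evalCLM ℂ (fun _ : W => ℂ) 2 w)
  have hpos : ∀ n w, 0 ≤ (((B ^ n) δ) w).re ∧ (((B ^ n) δ) w).im = 0 := by
    intro n
    induction n with
    | zero =>
      intro w
      by_cases h : w = o
      · subst h; simp [hδ]
      · simp [hδ, h, lp.single_apply]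
    | succ n ih =>
      intro w
      have : ((B ^ (n + 1)) δ) w = ((μ⁻¹ : ℝ) : ℂ) * ∑ u ∈ T.neighborFinset w, ((B ^ n) δ) u := by
        rw [pow_succ', Complex.ofReal_inv]; rfl
      rw [this, Complex.re_ofReal_mul, Complex.im_ofReal_mul, Complex.re_sum, Complex.im_sum]
      exact ⟨mul_nonneg (by positivity) (Finset.sum_nonneg fun u _ => (ih u).1), by
        rw [Finset.sum_eq_zero fun u _ => (ih u).2, mul_zero]⟩
  have hg0 : ∀ w, 0 ≤ ((S δ) w).re := fun w =>
    (Complex.hasSum_re (hev w)).nonneg fun n => (hpos n w).1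
  have hre : ∀ w, ((S δ) w).re = (δ w).re + μ⁻¹ * ∑ u ∈ T.neighborFinset w, ((S δ) u).re :=
    fun w => by
      conv_lhs => rw [hu w]
      rw [Complex.add_re, ← Complex.ofReal_inv, Complex.re_ofReal_mul, Complex.re_sum]
  refine ⟨fun w => ((S δ) w).re, hg0, ?_, fun w => ?_⟩
  · have h1 : (δ o).re = 1 := by simp [hδ]
    have h2 : 0 ≤ μ⁻¹ * ∑ u ∈ T.neighborFinset o, ((S δ) u).re :=
      mul_nonneg (by positivity) (Finset.sum_nonneg fun u _ => hg0 u)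
    simp only [hre o, h1]
    linarith
  · have h1 : 0 ≤ (δ w).re := by
      simpa using (hpos 0 w).1
    have h2 := hre w
    rw [inv_mul_eq_div] at h2
    have h3 : (∑ u ∈ T.neighborFinset w, ((S δ) u).re) / μ ≤ ((S δ) w).re := by linarith
    rwa [div_le_iff₀ hμ0, mul_comm] at h3

/-! ### Reduced walks and the universal covering tree. -/

namespace OrientedGraph

variable {V E : Type*}

theorem rev_rev (G : OrientedGraph V E) (e : G.Dart) : G.rev (G.rev e) = e := by
  simp [rev]

theorem source_rev (G : OrientedGraph V E) (e : G.Dart) : G.source (G.rev e) = G.target e := by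
  obtain ⟨e, _ | _⟩ := e <;> rfl

theorem target_rev (G : OrientedGraph V E) (e : G.Dart) : G.target (G.rev e) = G.source e := by
  obtain ⟨e, _ | _⟩ := e <;> rfl

open Classical in
/-- The reduced walk obtained from `l` by taking the step `e`. -/
noncomputable def step (G : OrientedGraph V E) (l : List G.Dart) (e : G.Dart) : List G.Dart :=
  if l.head? = some (G.rev e) then l.tail else e :: l

theorem step_rev_cons (G : OrientedGraph V E) (l : List G.Dart) (e : G.Dart) :
    G.step (G.rev e :: l) e = l := by
  simp [step]

theorem step_of_head?_ne (G : OrientedGraph V E) {l : List G.Dart} {e : G.Dart}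
    (h : l.head? ≠ some (G.rev e)) : G.step l e = e :: l := by
  simp [step, h]

theorem eq_rev_cons_of_head? (G : OrientedGraph V E) {l : List G.Dart} {e : G.Dart}
    (h : l.head? = some (G.rev e)) : ∃ l', l = G.rev e :: l' :=
  ⟨l.tail, (List.eq_cons_of_mem_head? h)⟩

theorem isReducedWalk_step (G : OrientedGraph V E) {v : V} {l : List G.Dart} {e : G.Dart}
    (hl : G.IsReducedWalk v l) (he : G.source e = G.endpoint v l) :
    G.IsReducedWalk v (G.step l e) := by
  by_cases h : l.head? = some (G.rev e)
  · obtain ⟨l', rfl⟩ := G.eq_rev_cons_of_head? h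
    rw [step_rev_cons]
    exact hl.1
  · rw [G.step_of_head?_ne h]
    exact ⟨hl, he, h⟩

theorem endpoint_step (G : OrientedGraph V E) {v : V} {l : List G.Dart} {e : G.Dart}
    (hl : G.IsReducedWalk v l) : G.endpoint v (G.step l e) = G.target e := by
  by_cases h : l.head? = some (G.rev e)
  · obtain ⟨l', rfl⟩ := G.eq_rev_cons_of_head? h
    rw [step_rev_cons, ← hl.2.1, source_rev]
  · rw [G.step_of_head?_ne h]
    rfl

theorem step_step_rev (G : OrientedGraph V E) {v : V} {l : List G.Dart} {e : G.Dart}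
    (hl : G.IsReducedWalk v l) : G.step (G.step l e) (G.rev e) = l := by
  by_cases h : l.head? = some (G.rev e)
  · obtain ⟨l', rfl⟩ := G.eq_rev_cons_of_head? h
    rw [step_rev_cons, step_of_head?_ne _ hl.2.2]
  · rw [G.step_of_head?_ne h]
    conv_lhs => rw [← G.rev_rev e]
    rw [G.rev_rev (G.rev e), step_rev_cons]

theorem step_injective (G : OrientedGraph V E) (l : List G.Dart) :
    Function.Injective (G.step l) := by
  intro e f h
  by_cases he : l.head? = some (G.rev e) <;> by_cases hf : l.head? = some (G.rev f)
  · rw [he, Option.some_inj] at hf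
    rw [← G.rev_rev e, hf, G.rev_rev]
  · obtain ⟨l', rfl⟩ := G.eq_rev_cons_of_head? he
    rw [step_rev_cons, step_of_head?_ne _ hf] at h
    exact absurd (congrArg List.length h) (by simp; omega)
  · obtain ⟨l', rfl⟩ := G.eq_rev_cons_of_head? hf
    rw [step_rev_cons, step_of_head?_ne _ he] at h
    exact absurd (congrArg List.length h) (by simp; omega)
  · rw [step_of_head?_ne _ he, step_of_head?_ne _ hf] at h
    exact (List.cons.inj h).1

/-- Extending a walk and undoing its last step are both instances of `step`. With `step_injective`,
the neighbours of `l` correspond to the darts leaving its endpoint. -/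
theorem universalCover_adj_iff (G : OrientedGraph V E) (v : V) (l l' : G.UniversalCoverVertex v) :
    (G.universalCover v).Adj l l' ↔
      ∃ e : G.Dart, G.source e = G.endpoint v l.1 ∧ l'.1 = G.step l.1 e := by
  rw [universalCover, SimpleGraph.fromRel_adj]
  constructor
  · rintro ⟨-, ⟨e, he⟩ | ⟨e, he⟩⟩
    · have h := l'.2
      rw [he] at h
      exact ⟨e, h.2.1, by rw [he, step_of_head?_ne _ h.2.2]⟩
    · have h := l.2
      rw [he] at h
      refine ⟨G.rev e, by rw [source_rev, he]; rfl, ?_⟩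
      rw [he]
      conv_rhs => rw [← G.rev_rev e]
      rw [G.rev_rev (G.rev e), step_rev_cons]
  · rintro ⟨e, he, hl⟩
    by_cases h : l.1.head? = some (G.rev e)
    · obtain ⟨l₁, h₁⟩ := G.eq_rev_cons_of_head? h
      rw [h₁, step_rev_cons] at hl
      refine ⟨fun hh => ?_, Or.inr ⟨G.rev e, by rw [h₁, hl]⟩⟩
      rw [← hh, h₁] at hl
      exact absurd (congrArg List.length hl) (by simp)
    · rw [step_of_head?_ne _ h] at hl
      refine ⟨fun hh => ?_, Or.inl ⟨e, hl⟩⟩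
      rw [← hh] at hl
      exact absurd (congrArg List.length hl) (by simp)

-- Strictness comes from a `μ` strictly between `rho` and `lam`. Positivity spreads from the root: a
-- zero at a walk would force, by superharmonicity, a zero at its parent.
open Classical in
theorem exists_pos_strict_superharmonic [Fintype E] (G : OrientedGraph V E) (v : V) {lam : ℝ}
    (h : G.rho v < lam) : ∃ f : List G.Dart → ℝ, ∀ l, G.IsReducedWalk v l → 0 < f l ∧
      ∑ e : G.Dart with G.source e = G.endpoint v l, f (G.step l e) < lam * f l := by
  obtain ⟨μ, hμ1, hμ2⟩ := exists_between h
  have hμ0 : 0 < μ := lt_of_le_of_lt ENNReal.toReal_nonneg hμ1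
  obtain ⟨g, hg0, hgo, hg⟩ := exists_nonneg_superharmonic (G.universalCover v) _
    (G.universalCover_degree_le v) ⟨[], trivial⟩ hμ1
  have hpos : ∀ l (hl : G.IsReducedWalk v l), 0 < g ⟨l, hl⟩ := by
    intro l
    induction l with
    | nil => exact fun _ => hgo
    | cons e l ih =>
      intro hl
      refine (hg0 _).lt_of_ne' fun h0 => ?_
      have h1 := hg ⟨e :: l, hl⟩
      rw [h0, mul_zero] at h1
      have h2 : (⟨l, hl.1⟩ : G.UniversalCoverVertex v) ∈
          (G.universalCover v).neighborFinset ⟨e :: l, hl⟩ := by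
        rw [SimpleGraph.mem_neighborFinset, SimpleGraph.adj_comm, universalCover_adj_iff]
        exact ⟨e, hl.2.1, (step_of_head?_ne _ hl.2.2).symm⟩
      have h3 := Finset.single_le_sum (fun u _ => hg0 u) h2
      exact absurd (ih hl.1) (not_lt.2 (h3.trans h1))
  refine ⟨fun l => if hl : G.IsReducedWalk v l then g ⟨l, hl⟩ else 0, fun l hl => ?_⟩
  simp only [dif_pos hl]
  refine ⟨hpos l hl, lt_of_le_of_lt (le_of_eq_of_le ?_ (hg ⟨l, hl⟩))
    (mul_lt_mul_of_pos_right hμ2 (hpos l hl))⟩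
  refine Finset.sum_bij (fun e he => ⟨G.step l e,
    G.isReducedWalk_step hl (Finset.mem_filter.1 he).2⟩) ?_ ?_ ?_ ?_
  · intro e he
    rw [SimpleGraph.mem_neighborFinset, universalCover_adj_iff]
    exact ⟨e, (Finset.mem_filter.1 he).2, rfl⟩
  · intro e _ f _ hef
    exact G.step_injective l (congrArg Subtype.val hef)
  · intro l' hl'
    rw [SimpleGraph.mem_neighborFinset, universalCover_adj_iff] at hl'
    obtain ⟨e, he, h'⟩ := hl'
    exact ⟨e, by simpa using he, Subtype.ext h'.symm⟩
  · intro e he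
    rw [dif_pos]

/-! ### No covering has a root beyond the spectral radius. -/

section RootBound

variable {V E : Type*}

theorem loopless_covering {G : OrientedGraph V E} (hG : G.Loopless) (d : ℕ)
    (σ : E → Equiv.Perm (Fin d)) : (G.covering d σ).Loopless := fun e h =>
  hG e.1 (congrArg Prod.fst h)

/-- The oriented edge of `G` below an oriented edge of a covering. -/
def coveringProj (G : OrientedGraph V E) (d : ℕ) (σ : E → Equiv.Perm (Fin d))
    (a : (G.covering d σ).Dart) : G.Dart := (a.1.1, a.2)

theorem source_coveringProj (G : OrientedGraph V E) (d : ℕ) (σ : E → Equiv.Perm (Fin d))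
    (a : (G.covering d σ).Dart) :
    G.source (G.coveringProj d σ a) = ((G.covering d σ).source a).1 := by
  obtain ⟨a, _ | _⟩ := a <;> rfl

theorem target_coveringProj (G : OrientedGraph V E) (d : ℕ) (σ : E → Equiv.Perm (Fin d))
    (a : (G.covering d σ).Dart) :
    G.target (G.coveringProj d σ a) = ((G.covering d σ).target a).1 := by
  obtain ⟨a, _ | _⟩ := a <;> rfl

theorem coveringProj_inj (G : OrientedGraph V E) (d : ℕ) (σ : E → Equiv.Perm (Fin d))
    {a b : (G.covering d σ).Dart}
    (hs : (G.covering d σ).source a = (G.covering d σ).source b)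
    (h : G.coveringProj d σ a = G.coveringProj d σ b) : a = b := by
  obtain ⟨⟨e, i⟩, x⟩ := a
  obtain ⟨⟨f, j⟩, y⟩ := b
  obtain ⟨rfl, rfl⟩ := Prod.mk.inj h
  have h2 := congrArg Prod.snd hs
  cases x
  · obtain rfl : i = j := h2
    rfl
  · obtain rfl : i = j := (σ e).injective h2
    rfl

open Classical in
/-- A function on the reduced walks from `v`, i.e. on the universal covering tree, that is positive
and strictly superharmonic for the adjacency operator at `lam`. -/
def IsSuperharmonic [Fintype E] (G : OrientedGraph V E) (v : V) (lam : ℝ)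
    (f : List G.Dart → ℝ) : Prop :=
  ∀ l, G.IsReducedWalk v l → 0 < f l ∧
    ∑ e : G.Dart with G.source e = G.endpoint v l, f (G.step l e) < lam * f l

variable [Fintype V] [Fintype E] [DecidableEq V] [DecidableEq E]

-- Darts of the covering leaving `h` project injectively to darts of `G` leaving `h.1`, and omitting
-- positive terms only lowers the sum.
omit [Fintype V] [DecidableEq V] [DecidableEq E] in
theorem sum_step_le_of_isSuperharmonic (G : OrientedGraph V E) (d : ℕ)
    (σ : E → Equiv.Perm (Fin d)) {v : V} {lam : ℝ} {f : List G.Dart → ℝ}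
    (hf : G.IsSuperharmonic v lam f) {l : List G.Dart} (hl : G.IsReducedWalk v l)
    {h : V × Fin d} (hh : G.endpoint v l = h.1) (F : Finset (G.covering d σ).Dart)
    (hF : ∀ a ∈ F, (G.covering d σ).source a = h) :
    ∑ a ∈ F, f (G.step l (G.coveringProj d σ a)) < lam * f l := by
  classical
  refine lt_of_le_of_lt ?_ (hf l hl).2
  have hinj : Set.InjOn (G.coveringProj d σ) F := fun a ha b hb hab =>
    G.coveringProj_inj d σ ((hF a ha).trans (hF b hb).symm) hab
  rw [← Finset.sum_image (f := fun e => f (G.step l e)) hinj]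
  refine Finset.sum_le_sum_of_subset_of_nonneg ?_ ?_
  · intro e he
    obtain ⟨a, ha, rfl⟩ := Finset.mem_image.1 he
    rw [Finset.mem_filter, source_coveringProj, hF a ha, hh]
    exact ⟨Finset.mem_univ _, rfl⟩
  · intro e he _
    exact (hf _ (G.isReducedWalk_step hl (Finset.mem_filter.1 he).2)).1.le

omit [Fintype V] in
theorem matchingSum_univ_eq_sub_sum {R : Type*} [CommRing R] (G : OrientedGraph V E)
    (hG : G.Loopless) (S : Finset V) {w : V} (hw : w ∈ S) (x : V → R) :
    G.matchingSum Finset.univ S x = x w * G.matchingSum Finset.univ (S.erase w) x -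
      ∑ a : G.Dart with G.source a = w ∧ G.target a ∈ S,
        G.matchingSum Finset.univ ((S.erase w).erase (G.target a)) x := by
  rw [G.matchingSum_eq_sub_sum hG _ _ hw, Finset.sum_filter, Fintype.sum_prod_type]
  simp only [Fintype.sum_bool, source, target, if_true, Bool.false_eq_true, if_false]

-- Positivity and the ratio bound are proved together by induction on `S.card`. Expanding at `h` and
-- bounding each neighbour's term by the ratio bound for `S.erase h` gives `key`. Superharmonicity
-- makes the bracket in `key` positive; if a dart `a` leaves `S`, the bracket even exceeds the value
-- of `f` one step along `a`.
omit [Fintype V] in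
theorem matchingSum_covering_pos (G : OrientedGraph V E) (hG : G.Loopless) (d : ℕ)
    (σ : E → Equiv.Perm (Fin d)) {lam : ℝ}
    (hlam : ∀ u, ∃ v l, G.IsReducedWalk v l ∧ G.endpoint v l = u ∧ G.rho v < lam)
    (S : Finset (V × Fin d)) :
    0 < (G.covering d σ).matchingSum Finset.univ S (fun _ => lam) ∧
      ∀ h ∈ S, ∀ v f l, G.IsSuperharmonic v lam f → G.IsReducedWalk v l →
        G.endpoint v l = h.1 → ∀ a, (G.covering d σ).source a = h → (G.covering d σ).target a ∉ S →
        f (G.step l (G.coveringProj d σ a)) *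
            (G.covering d σ).matchingSum Finset.univ (S.erase h) (fun _ => lam) ≤
          f l * (G.covering d σ).matchingSum Finset.univ S (fun _ => lam) := by
  classical
  induction hn : S.card using Nat.strong_induction_on generalizing S with
  | _ n ih =>
  set H := G.covering d σ with hH
  set m : Finset (V × Fin d) → ℝ := fun S => H.matchingSum Finset.univ S (fun _ => lam) with hm
  have key : ∀ h ∈ S, 0 < m (S.erase h) ∧ ∀ v f l, G.IsSuperharmonic v lam f →
      G.IsReducedWalk v l → G.endpoint v l = h.1 →
      m (S.erase h) * (lam * f l - ∑ a : H.Dart with H.source a = h ∧ H.target a ∈ S,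
        f (G.step l (G.coveringProj d σ a))) ≤ f l * m S := by
    intro h hh
    obtain ⟨hpos, hle⟩ := ih _ (by rw [← hn]; exact Finset.card_erase_lt_of_mem hh) (S.erase h) rfl
    refine ⟨hpos, fun v f l hf hl he => ?_⟩
    have hrec : m S = lam * m (S.erase h) -
        ∑ a : H.Dart with H.source a = h ∧ H.target a ∈ S, m ((S.erase h).erase (H.target a)) :=
      H.matchingSum_univ_eq_sub_sum (loopless_covering hG d σ) S hh _
    have hsum : f l * ∑ a : H.Dart with H.source a = h ∧ H.target a ∈ S,
          m ((S.erase h).erase (H.target a)) ≤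
        m (S.erase h) * ∑ a : H.Dart with H.source a = h ∧ H.target a ∈ S,
          f (G.step l (G.coveringProj d σ a)) := by
      rw [Finset.mul_sum, Finset.mul_sum]
      refine Finset.sum_le_sum fun a ha => ?_
      obtain ⟨ha1, ha2⟩ := (Finset.mem_filter.1 ha).2
      have hne : H.target a ≠ h := by
        rw [← ha1]
        obtain ⟨a, _ | _⟩ := a
        · exact (loopless_covering hG d σ a).symm
        · exact loopless_covering hG d σ a
      have hsrc : G.source (G.coveringProj d σ a) = G.endpoint v l := by
        rw [source_coveringProj, ha1, he]
      -- The dart leaving `S.erase h` is the reversal of `a`: it points to the vertex `h` just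
      -- removed, and stepping along it returns the walk to `l`.
      have := hle (H.target a) (Finset.mem_erase.2 ⟨hne, ha2⟩) v f
        (G.step l (G.coveringProj d σ a)) hf (G.isReducedWalk_step hl hsrc)
        (by rw [G.endpoint_step hl, target_coveringProj]) (H.rev a) (H.source_rev a)
        (by rw [H.target_rev, ha1]; simp)
      have hrev : G.coveringProj d σ (H.rev a) = G.rev (G.coveringProj d σ a) := rfl
      rw [hrev, G.step_step_rev hl] at this
      rw [mul_comm (m (S.erase h))]
      exact this
    rw [hrec, mul_sub, mul_sub]
    linarith
  constructor
  · rcases S.eq_empty_or_nonempty with rfl | ⟨h, hh⟩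
    · suffices h : ∀ A : Finset (E × Fin d), H.matchingSum A ∅ (fun _ => lam) = 1 by
        rw [h]; exact one_pos
      intro A
      induction A using Finset.induction_on with
      | empty => simp [matchingSum_empty]
      | insert e A he ih =>
        rw [H.matchingSum_insert he (loopless_covering hG d σ e), ih]
        simp
    · obtain ⟨v, l, hl, he, hv⟩ := hlam h.1
      obtain ⟨f, hf⟩ := G.exists_pos_strict_superharmonic v hv
      have hf' : G.IsSuperharmonic v lam f := hf
      obtain ⟨hpos, hk⟩ := key h hh
      have h1 := hk v f l hf' hl he
      have h2 := G.sum_step_le_of_isSuperharmonic d σ hf' hl he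
        (Finset.univ.filter fun a : H.Dart => H.source a = h ∧ H.target a ∈ S)
        (fun a ha => (Finset.mem_filter.1 ha).2.1)
      have h3 : 0 < f l * m S := lt_of_lt_of_le (mul_pos hpos (sub_pos.2 h2)) h1
      exact (pos_iff_pos_of_mul_pos h3).1 (hf l hl).1
  · intro h hh v f l hf hl he a ha ha'
    obtain ⟨hpos, hk⟩ := key h hh
    refine le_trans ?_ (hk v f l hf hl he)
    -- Since `a` leaves `S`, it is absent from the sum in `key`, and its term remains available in
    -- the superharmonic inequality.
    have h2 := G.sum_step_le_of_isSuperharmonic d σ hf hl he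
        (insert a (Finset.univ.filter fun a : H.Dart => H.source a = h ∧ H.target a ∈ S))
        (fun b hb => by
          rcases Finset.mem_insert.1 hb with rfl | hb
          · exact ha
          · exact (Finset.mem_filter.1 hb).2.1)
    rw [Finset.sum_insert (fun hb => ha' (Finset.mem_filter.1 hb).2.2)] at h2
    rw [mul_comm]
    exact mul_le_mul_of_nonneg_left (by linarith) hpos.le

-- This passes from the classical instances in the definition of `dMatchingPoly` to the ambient
-- ones.
omit [DecidableEq V] in
theorem exists_dMatchingPoly_eq (G : OrientedGraph V E) (d : ℕ) : ∃ c : ℝ, c ≠ 0 ∧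
    G.dMatchingPoly d = C c * ∑ σ : E → Equiv.Perm (Fin d), (G.covering d σ).matchingPoly := by
  refine ⟨(Fintype.card (E → Equiv.Perm (Fin d)) : ℝ)⁻¹,
    inv_ne_zero (Nat.cast_ne_zero.2 Fintype.card_ne_zero), ?_⟩
  rw [dMatchingPoly]
  congr!

/-- All summands are positive at `|x|`. The form of `hlam` allows one base point for all `u`
(connected case) or each `u` as its own base point (general case). -/
theorem dMatchingPoly_eval_ne_zero_of_rho_lt (G : OrientedGraph V E) (hG : G.Loopless) (d : ℕ)
    {x : ℝ} (hlam : ∀ u, ∃ v l, G.IsReducedWalk v l ∧ G.endpoint v l = u ∧ G.rho v < |x|) :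
    (G.dMatchingPoly d).eval x ≠ 0 := by
  classical
  have hpos : ∀ σ, 0 < (G.covering d σ).matchingPoly.eval |x| := fun σ => by
    have := (G.matchingSum_covering_pos hG d σ hlam Finset.univ).1
    rwa [← aeval_matchingPoly, coe_aeval_eq_eval] at this
  -- The exponents in a matching polynomial all have the parity of the number of vertices, which is
  -- the same for every covering.
  have hsign : ∀ σ, (G.covering d σ).matchingPoly.eval (-x) =
      (-1) ^ (Fintype.card (V × Fin d)) * (G.covering d σ).matchingPoly.eval x := fun σ => by
    simp only [matchingPoly, eval_finsetSum, eval_mul, eval_C, eval_pow, eval_X, Finset.mul_sum]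
    refine Finset.sum_congr rfl fun i hi => ?_
    have hi' : 2 * i ≤ Fintype.card (V × Fin d) := by
      have := Finset.mem_range.1 hi
      omega
    have h1 : (-1 : ℝ) ^ (Fintype.card (V × Fin d) - 2 * i) =
        (-1) ^ (Fintype.card (V × Fin d)) := by
      obtain ⟨k, hk⟩ := Nat.exists_eq_add_of_le hi'
      rw [hk, Nat.add_sub_cancel_left, pow_add, pow_mul]
      simp
    rw [neg_pow x, h1]
    ring
  have hsum : ∑ σ, (G.covering d σ).matchingPoly.eval x ≠ 0 := by
    have h : 0 < ∑ σ, (G.covering d σ).matchingPoly.eval |x| :=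
      Finset.sum_pos (fun σ _ => hpos σ) Finset.univ_nonempty
    rcases abs_choice x with hx | hx
    · rw [hx] at h
      exact h.ne'
    · simp only [hx, hsign, ← Finset.mul_sum] at h
      exact right_ne_zero_of_mul h.ne'
  obtain ⟨c, hc, h⟩ := G.exists_dMatchingPoly_eq d
  rw [h, eval_mul, eval_C, eval_finsetSum]
  exact mul_ne_zero hc hsum

omit [Fintype V] [Fintype E] [DecidableEq V] [DecidableEq E] in
theorem exists_isReducedWalk_of_connected (G : OrientedGraph V E) (hG : G.Connected) (v u : V) :
    ∃ l, G.IsReducedWalk v l ∧ G.endpoint v l = u := by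
  obtain ⟨p⟩ := hG.preconnected u v
  induction p with
  | nil => exact ⟨[], trivial, rfl⟩
  | cons h p ih =>
    obtain ⟨l, hl, he⟩ := ih
    rw [SimpleGraph.fromRel_adj] at h
    obtain ⟨-, ⟨e, rfl, ht⟩ | ⟨e, ht, rfl⟩⟩ := h
    · exact ⟨G.step l (e, true), G.isReducedWalk_step hl (ht.trans he.symm), G.endpoint_step hl⟩
    · exact ⟨G.step l (e, false), G.isReducedWalk_step hl (ht.trans he.symm), G.endpoint_step hl⟩

end RootBound

end OrientedGraph

/-! ### Stability of biaffine polynomials. -/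

section Stability

/-- `a - e` is the value at the origin of `1 - ∂_y ∂_z` applied to the polynomial. If `a = e`,
normalizing gives `1 + B y + C z + y z`, for which a zero in the region is exhibited. -/
theorem sub_ne_zero_of_biaffine_ne_zero {ε : ℝ} (hε : 0 < ε) {a b c e : ℂ}
    (h : ∀ y z : ℂ, -ε < y.im → -ε < z.im → a + b * y + c * z + e * (y * z) ≠ 0) :
    a - e ≠ 0 := by
  intro hae
  obtain rfl := sub_eq_zero.1 hae
  have ha : a ≠ 0 := by simpa using h 0 0 (by simpa) (by simpa)
  have h' : ∀ y z : ℂ, -ε < y.im → -ε < z.im → 1 + b / a * y + c / a * z + y * z ≠ 0 := by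
    intro y z hy hz h0
    refine h y z hy hz ?_
    have : a * (1 + b / a * y + c / a * z + y * z) = 0 := by rw [h0, mul_zero]
    rw [← this]
    field_simp
  generalize b / a = B at h'
  generalize c / a = C at h'
  by_cases hC : 0 < C.im
  · have hC0 : C ≠ 0 := fun h => by simp [h] at hC
    refine h' 0 (-C⁻¹) (by simpa) ?_ (by field_simp; ring)
    rw [Complex.neg_im, Complex.inv_im, neg_div, neg_neg]
    have : 0 ≤ C.im / Complex.normSq C := div_nonneg hC.le (Complex.normSq_nonneg _)
    linarith
  · set D := B * C - 1 with hD
    set t : ℝ := ‖B‖ + ‖D‖ / ε + 1 with ht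
    have htD : ‖D‖ / ε < t := by have := norm_nonneg B; rw [ht]; linarith
    have htB : ‖B‖ < t := by
      have : 0 ≤ ‖D‖ / ε := by positivity
      rw [ht]; linarith
    have ht0 : 0 < t := by positivity
    have ht0' : (t : ℂ) ≠ 0 := Complex.ofReal_ne_zero.2 ht0.ne'
    -- A zero means `(y + C) * (z + B) = D`. With `z + B = i t` and `t` large, `y` is within `ε` of
    -- `-C`, and `-C` has nonnegative imaginary part here.
    refine h' (-C + D / (t * Complex.I)) (-B + t * Complex.I) ?_ ?_ ?_
    · have h1 : |(D / (t * Complex.I)).im| ≤ ‖D‖ / t := by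
        refine (Complex.abs_im_le_norm _).trans_eq ?_
        simp [abs_of_pos ht0]
      have h2 : ‖D‖ / t < ε := by
        rw [div_lt_iff₀ hε] at htD
        rw [div_lt_iff₀ ht0]
        linarith
      have h3 := (abs_le.1 h1).1
      rw [Complex.add_im, Complex.neg_im]
      linarith
    · have h1 := (abs_le.1 (Complex.abs_im_le_norm B)).2
      simp only [Complex.add_im, Complex.neg_im, Complex.mul_im, Complex.ofReal_re, Complex.I_im,
        Complex.ofReal_im, Complex.I_re]
      linarith
    · rw [hD]
      field_simp
      ring

/-- Write `D = (D / (i t)) * (i t)`: for large `t` the first factor is near `0`, which would lie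
inside its half-plane if `γ < 0`. -/
theorem nonneg_of_mul_ne {γ β : ℝ} {D : ℂ}
    (h : ∀ u v : ℂ, γ < u.im → β < v.im → u * v ≠ D) : 0 ≤ γ := by
  by_contra! hγ
  set t : ℝ := |β| + ‖D‖ / (-γ) + 1 with ht
  have hγ' : 0 < -γ := by linarith
  have htβ : β < t := by
    have := le_abs_self β
    have : 0 ≤ ‖D‖ / (-γ) := by positivity
    rw [ht]; linarith
  have htD : ‖D‖ / (-γ) < t := by have := abs_nonneg β; rw [ht]; linarith
  have ht0 : 0 < t := by positivity
  have ht0' : (t : ℂ) ≠ 0 := Complex.ofReal_ne_zero.2 ht0.ne'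
  refine h (D / (t * Complex.I)) (t * Complex.I) ?_ (by simpa) (by field_simp)
  have h1 : |(D / (t * Complex.I)).im| ≤ ‖D‖ / t := by
    refine (Complex.abs_im_le_norm _).trans_eq ?_
    simp [abs_of_pos ht0]
  have h2 : ‖D‖ / t < -γ := by
    rw [div_lt_iff₀ hγ'] at htD
    rw [div_lt_iff₀ ht0]
    linarith
  have h3 := (abs_le.1 h1).1
  linarith

/-- The products of two numbers in open half-planes avoid `D` only if `D` lies in a parabola. -/
theorem norm_sub_re_le_of_mul_ne {γ β : ℝ} {D : ℂ}
    (h : ∀ u v : ℂ, γ < u.im → β < v.im → u * v ≠ D) : ‖D‖ - D.re ≤ 2 * (γ * β) := by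
  have hγ := nonneg_of_mul_ne h
  have hβ : 0 ≤ β := nonneg_of_mul_ne (fun u v hu hv => by rw [mul_comm]; exact h v u hv hu)
  have key : ∀ y, β < y → ‖D‖ - D.re ≤ 2 * (γ * y) := by
    intro y hy
    have hy0 : 0 < y := hβ.trans_lt hy
    -- For `v = x + i y` the hypothesis says `Im (D / v) ≤ γ`. Its discriminant in `x` yields `‖D‖ ^
    -- 2 ≤ (2 γ y + Re D) ^ 2`; then `y` tends to `β`.
    have hx : ∀ x : ℝ, 0 ≤ γ * (x * x) + (-D.im) * x + (γ * y ^ 2 + D.re * y) := by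
      intro x
      set v : ℂ := ⟨x, y⟩ with hv
      have hv0 : v ≠ 0 := fun h0 => hy0.ne' (congrArg Complex.im h0)
      have h1 : ¬ γ < (D / v).im := fun hu => h _ v hu hy (div_mul_cancel₀ _ hv0)
      rw [not_lt, Complex.div_im, ← sub_div, div_le_iff₀ (Complex.normSq_pos.2 hv0),
        Complex.normSq_apply] at h1
      simp only [hv] at h1
      nlinarith
    have hd := discrim_le_zero hx
    have h0 := hx 0
    have h2 : 0 ≤ γ * y + D.re := by
      by_contra! hneg
      nlinarith
    have h3 : 0 ≤ γ * y := mul_nonneg hγ hy0.le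
    have h4 : ‖D‖ ^ 2 ≤ (2 * (γ * y) + D.re) ^ 2 := by
      rw [← Complex.normSq_eq_norm_sq, Complex.normSq_apply]
      rw [discrim] at hd
      nlinarith
    have := abs_le_of_sq_le_sq' h4 (by linarith)
    linarith [this.2]
  have hlim : Filter.Tendsto (fun y : ℝ => 2 * (γ * y)) (nhdsWithin β (Set.Ioi β))
      (nhds (2 * (γ * β))) := by
    refine Filter.Tendsto.mono_left ?_ nhdsWithin_le_nhds
    exact Continuous.tendsto (by fun_prop) _
  exact ge_of_tendsto hlim (Filter.eventually_of_mem self_mem_nhdsWithin key)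

/-- By Cauchy–Schwarz, `‖u v‖ - Re (u v) ≥ 2 Im u Im v`, which exceeds `2 γ β`. -/
theorem mul_ne_of_norm_sub_re_le {γ β : ℝ} {D : ℂ} (hγ : 0 ≤ γ) (hβ : 0 ≤ β)
    (h : ‖D‖ - D.re ≤ 2 * (γ * β)) {u v : ℂ} (hu : γ < u.im) (hv : β < v.im) : u * v ≠ D := by
  rintro rfl
  have h1 : γ * β < u.im * v.im := mul_lt_mul'' hu hv hγ hβ
  have h2 : u.re * v.re + u.im * v.im ≤ ‖u‖ * ‖v‖ := by
    refine (le_abs_self _).trans (abs_le_of_sq_le_sq ?_ (by positivity))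
    rw [mul_pow, ← Complex.normSq_eq_norm_sq, ← Complex.normSq_eq_norm_sq, Complex.normSq_apply,
      Complex.normSq_apply]
    nlinarith [sq_nonneg (u.re * v.im - u.im * v.re)]
  rw [norm_mul, Complex.mul_re] at h
  linarith

/-- Partial symmetrization preserves stability of biaffine polynomials, monic case. -/
theorem biaffine_symm_ne_zero_of_monic {η p q : ℝ} (hp : 0 ≤ p) (hq : 0 ≤ q) (hpq : p + q = 1)
    {a b c : ℂ} (h : ∀ y z : ℂ, η < y.im → η < z.im → a + b * y + c * z + y * z ≠ 0)
    {y z : ℂ} (hy : η < y.im) (hz : η < z.im) :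
    p * (a + b * y + c * z + y * z) + q * (a + b * z + c * y + z * y) ≠ 0 := by
  have hD : ∀ u v : ℂ, c.im + η < u.im → b.im + η < v.im → u * v ≠ b * c - a := by
    intro u v hu hv huv
    refine h (u - c) (v - b) (by rw [Complex.sub_im]; linarith) (by rw [Complex.sub_im]; linarith)
      ?_
    linear_combination huv
  have hγ := nonneg_of_mul_ne hD
  have hβ : 0 ≤ b.im + η := nonneg_of_mul_ne (D := b * c - a) (β := c.im + η)
    (fun u v hu hv => by rw [mul_comm]; exact hD v u hv hu)
  have hle := norm_sub_re_le_of_mul_ne hD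
  obtain rfl : q = 1 - p := by linarith
  -- The average is again a product of two linear factors minus a constant, now `b c - a + p q (b -
  -- c) ^ 2`. The left side grows by at most `2 p q (Im (b - c)) ^ 2`, and the right side by exactly
  -- that.
  have hle' : ‖b * c - a + ((p * (1 - p) : ℝ) : ℂ) * (b - c) ^ 2‖ -
      (b * c - a + ((p * (1 - p) : ℝ) : ℂ) * (b - c) ^ 2).re ≤
      2 * ((p * c.im + (1 - p) * b.im + η) * (p * b.im + (1 - p) * c.im + η)) := by
    have h1 := norm_add_le (b * c - a) (((p * (1 - p) : ℝ) : ℂ) * (b - c) ^ 2)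
    rw [norm_mul, norm_pow, ← Complex.normSq_eq_norm_sq, Complex.normSq_apply, Complex.norm_real,
      Real.norm_of_nonneg (mul_nonneg hp hq)] at h1
    rw [Complex.add_re, Complex.re_ofReal_mul, sq (b - c), Complex.mul_re]
    rw [sq (b - c)] at h1
    simp only [Complex.sub_re, Complex.sub_im] at h1 hle ⊢
    nlinarith
  have hfin := mul_ne_of_norm_sub_re_le (u := y + (p * c + (1 - p : ℝ) * b))
    (v := z + (p * b + (1 - p : ℝ) * c)) (by nlinarith) (by nlinarith) hle'
    (by simp only [Complex.add_im, Complex.im_ofReal_mul]; linarith)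
    (by simp only [Complex.add_im, Complex.im_ofReal_mul]; linarith)
  intro h0
  refine hfin ?_
  push_cast at h0 ⊢
  linear_combination h0

/-- After scaling to `p + q = 1`, the case `e = 0` is evaluation at convex combinations of `y` and
`z`; otherwise dividing by `e` gives the monic case. -/
theorem biaffine_symm_ne_zero {η p q : ℝ} (hp : 0 ≤ p) (hq : 0 ≤ q) (hpq : 0 < p + q)
    {a b c e : ℂ} (h : ∀ y z : ℂ, η < y.im → η < z.im → a + b * y + c * z + e * (y * z) ≠ 0)
    {y z : ℂ} (hy : η < y.im) (hz : η < z.im) :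
    p * (a + b * y + c * z + e * (y * z)) + q * (a + b * z + c * y + e * (z * y)) ≠ 0 := by
  wlog hone : p + q = 1 generalizing p q
  · have h1 := this (p := p / (p + q)) (q := q / (p + q)) (by positivity) (by positivity)
      (by rw [← add_div, div_self hpq.ne']; exact one_pos) (by rw [← add_div, div_self hpq.ne'])
    intro h0
    refine h1 ?_
    have hc : ((p + q : ℝ) : ℂ) ≠ 0 := Complex.ofReal_ne_zero.2 hpq.ne'
    have : ((p + q : ℝ) : ℂ)⁻¹ * (p * (a + b * y + c * z + e * (y * z)) +
      q * (a + b * z + c * y + e * (z * y))) = 0 := by rw [h0, mul_zero]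
    rw [← this]
    push_cast at hc ⊢
    field_simp
  by_cases he : e = 0
  · subst he
    have h1 := h (p * y + q * z) (p * z + q * y)
      (by simpa [Complex.im_ofReal_mul] using convex_Ioi η hy hz hp hq hone)
      (by simpa [Complex.im_ofReal_mul] using convex_Ioi η hz hy hp hq hone)
    intro h0
    refine h1 ?_
    have hc : (p : ℂ) + q = 1 := by exact_mod_cast hone
    linear_combination h0 - a * hc
  · have h1 := biaffine_symm_ne_zero_of_monic hp hq hone (a := a / e) (b := b / e) (c := c / e)
      (η := η) (fun y z hy hz h0 => h y z hy hz (by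
        have : e * (a / e + b / e * y + c / e * z + y * z) = 0 := by rw [h0, mul_zero]
        rw [← this]; field_simp)) hy hz
    intro h0
    refine h1 ?_
    have : e⁻¹ * (p * (a + b * y + c * z + e * (y * z)) +
      q * (a + b * z + c * y + e * (z * y))) = 0 := by rw [h0, mul_zero]
    rw [← this]
    field_simp

/-! ### Multiaffine functions and full symmetrization. -/

/-- Functions that are affine in each variable. -/
def IsMultiaffine {ι : Type*} [DecidableEq ι] (Q : (ι → ℂ) → ℂ) : Prop :=
  ∀ y i, ∃ a b : ℂ, ∀ s, Q (Function.update y i s) = a + b * s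

namespace IsMultiaffine

variable {ι κ : Type*} [DecidableEq ι] [DecidableEq κ] {Q : (ι → ℂ) → ℂ}

theorem sum {α : Type*} {s : Finset α} {Q : α → (ι → ℂ) → ℂ} (h : ∀ k ∈ s, IsMultiaffine (Q k)) :
    IsMultiaffine (fun y => ∑ k ∈ s, Q k y) := by
  intro y i
  have h' : ∀ k, ∃ ab : ℂ × ℂ, k ∈ s → ∀ t, Q k (Function.update y i t) = ab.1 + ab.2 * t := by
    intro k
    by_cases hk : k ∈ s
    · obtain ⟨a, b, hab⟩ := h k hk y i
      exact ⟨(a, b), fun _ => hab⟩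
    · exact ⟨0, fun h => absurd h hk⟩
  choose ab hab using h'
  refine ⟨∑ k ∈ s, (ab k).1, ∑ k ∈ s, (ab k).2, fun t => ?_⟩
  rw [Finset.sum_mul, ← Finset.sum_add_distrib]
  exact Finset.sum_congr rfl fun k hk => hab k hk t

theorem add {Q P : (ι → ℂ) → ℂ} (hQ : IsMultiaffine Q) (hP : IsMultiaffine P) :
    IsMultiaffine (fun y => Q y + P y) := by
  intro y i
  obtain ⟨a, b, h⟩ := hQ y i
  obtain ⟨a', b', h'⟩ := hP y i
  exact ⟨a + a', b + b', fun s => by dsimp only; rw [h, h']; ring⟩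

theorem const_mul (hQ : IsMultiaffine Q) (c : ℂ) : IsMultiaffine (fun y => c * Q y) := by
  intro y i
  obtain ⟨a, b, h⟩ := hQ y i
  exact ⟨c * a, c * b, fun s => by dsimp only; rw [h]; ring⟩

theorem comp_equiv (hQ : IsMultiaffine Q) (π : ι ≃ κ) : IsMultiaffine (fun y : κ → ℂ => Q (y ∘ π)) := by
  intro y i
  obtain ⟨a, b, h⟩ := hQ (y ∘ π) (π.symm i)
  refine ⟨a, b, fun s => ?_⟩
  dsimp only
  rw [← h, Function.update_comp_equiv]

theorem exists_biaffine (hQ : IsMultiaffine Q) (y : ι → ℂ) {i j : ι} (hij : i ≠ j) :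
    ∃ a b c e : ℂ, ∀ s t, Q (Function.update (Function.update y i s) j t) =
      a + b * s + c * t + e * (s * t) := by
  obtain ⟨a, b, h0⟩ := hQ (Function.update y j 0) i
  obtain ⟨a', b', h1⟩ := hQ (Function.update y j 1) i
  refine ⟨a, b, a' - a, b' - b, fun s t => ?_⟩
  obtain ⟨a'', b'', h⟩ := hQ (Function.update y i s) j
  have e0 := h 0
  have e1 := h 1
  rw [Function.update_comm hij, h0] at e0
  rw [Function.update_comm hij, h1] at e1
  rw [h]
  linear_combination (t - 1) * e0 - t * e1

theorem add_swap_ne_zero (hQ : IsMultiaffine Q) {η : ℝ}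
    (h : ∀ y : ι → ℂ, (∀ i, η < (y i).im) → Q y ≠ 0) {p q : ℝ} (hp : 0 ≤ p) (hq : 0 ≤ q)
    (hpq : 0 < p + q) {i j : ι} (hij : i ≠ j) (y : ι → ℂ) (hy : ∀ i, η < (y i).im) :
    p * Q y + q * Q (y ∘ Equiv.swap i j) ≠ 0 := by
  obtain ⟨a, b, c, e, hab⟩ := hQ.exists_biaffine y hij
  have h1 : Q y = a + b * y i + c * y j + e * (y i * y j) := by
    rw [← hab, Function.update_eq_self, Function.update_eq_self]
  have h2 : Q (y ∘ Equiv.swap i j) = a + b * y j + c * y i + e * (y j * y i) := by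
    rw [← hab]
    congr 1
    ext k
    by_cases hk : k = j
    · subst hk; simp
    · by_cases hk' : k = i
      · subst hk'; simp [hk]
      · simp [hk, hk', Equiv.swap_apply_of_ne_of_ne]
  rw [h1, h2]
  refine biaffine_symm_ne_zero hp hq hpq (fun s t hs ht => ?_) (hy i) (hy j)
  rw [← hab]
  refine h _ fun k => ?_
  by_cases hk : k = j
  · subst hk; simpa
  · by_cases hk' : k = i
    · subst hk'; simpa [hk]
    · simpa [hk, hk'] using hy k

end IsMultiaffine

theorem swap_mul_decomposeFin_symm {n : ℕ} (k : Fin (n + 1)) (π : Equiv.Perm (Fin n)) :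
    Equiv.Perm.decomposeFin.symm (k, π) =
      Equiv.swap 0 k * Equiv.Perm.decomposeFin.symm (0, π) := by
  ext x
  refine Fin.cases ?_ (fun x => ?_) x <;> simp

theorem swap_succ_mul_decomposeFin_symm {n : ℕ} (k l : Fin n) (π : Equiv.Perm (Fin n)) :
    Equiv.swap k.succ l.succ * Equiv.Perm.decomposeFin.symm (0, π) =
      Equiv.Perm.decomposeFin.symm (0, Equiv.swap k l * π) := by
  ext x
  refine Fin.cases ?_ (fun x => ?_) x
  · simp [Equiv.swap_apply_of_ne_of_ne, (Fin.succ_ne_zero _).symm]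
  · simp [(Fin.succ_injective n).swap_apply]

/-- Symmetrization of a multiaffine stable function over all permutations of the variables. -/
theorem IsMultiaffine.sum_perm_ne_zero {n : ℕ} {Q : (Fin n → ℂ) → ℂ} (hQ : IsMultiaffine Q) {η : ℝ}
    (h : ∀ y : Fin n → ℂ, (∀ i, η < (y i).im) → Q y ≠ 0) (y : Fin n → ℂ)
    (hy : ∀ i, η < (y i).im) : ∑ π : Equiv.Perm (Fin n), Q (y ∘ π) ≠ 0 := by
  induction n with
  | zero =>
    rw [Fintype.sum_unique]
    exact h _ fun i => i.elim0
  | succ n ih =>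
    -- `Q'` symmetrizes over the stabilizer of `0`; the swaps of `0` with `k`, and the identity, are
    -- coset representatives.
    set Q' : (Fin (n + 1) → ℂ) → ℂ := fun y =>
      ∑ π : Equiv.Perm (Fin n), Q (y ∘ Equiv.Perm.decomposeFin.symm (0, π)) with hQ'
    have hQ'm : IsMultiaffine Q' := IsMultiaffine.sum fun π _ => hQ.comp_equiv _
    have hQ'0 : ∀ y : Fin (n + 1) → ℂ, (∀ i, η < (y i).im) → Q' y ≠ 0 := by
      intro y hy
      have hc := ih (Q := fun z => Q (Fin.cons (y 0) z)) (fun z i => by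
          obtain ⟨a, b, hab⟩ := hQ (Fin.cons (y 0) z) i.succ
          exact ⟨a, b, fun s => by dsimp only; rw [← hab, Fin.cons_update]⟩)
        (fun z hz => h _ (Fin.cases (by simpa using hy 0) (fun i => by simpa using hz i)))
        (Fin.tail y) (fun i => hy i.succ)
      convert hc using 3 with π
      ext x
      refine Fin.cases ?_ (fun x => ?_) x <;> simp [Fin.tail]
    have hinv : ∀ (k l : Fin n) y, Q' (y ∘ Equiv.swap k.succ l.succ) = Q' y := by
      intro k l y
      refine Fintype.sum_equiv (Equiv.mulLeft (Equiv.swap k l)) _ _ fun π => ?_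
      rw [Equiv.coe_mulLeft, ← swap_succ_mul_decomposeFin_symm, Equiv.Perm.coe_mul]
      rfl
    -- The swaps enter one by one. Partial symmetrization with weights `n - t.card` and `1` produces
    -- `n + 1 - t.card` times the next sum, because `Q'` is invariant under swaps fixing `0`. For
    -- `t` full, the coefficient of `Q'` is `1`.
    have key : ∀ t : Finset (Fin n), ∀ y : Fin (n + 1) → ℂ, (∀ i, η < (y i).im) →
        ((n + 1 - t.card : ℝ) : ℂ) * Q' y + ∑ k ∈ t, Q' (y ∘ Equiv.swap 0 k.succ) ≠ 0 := by
      intro t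
      induction t using Finset.induction_on with
      | empty =>
        intro y hy
        rw [Finset.sum_empty, add_zero]
        refine mul_ne_zero (Complex.ofReal_ne_zero.2 ?_) (hQ'0 y hy)
        rw [Finset.card_empty, Nat.cast_zero, sub_zero]
        positivity
      | insert k t hk iht =>
        intro y hy
        have hcard : (t.card : ℝ) + 1 ≤ n := by
          have := Finset.card_le_univ (insert k t)
          rw [Finset.card_insert_of_notMem hk, Fintype.card_fin] at this
          exact_mod_cast this
        have hP : IsMultiaffine (fun y => ((n + 1 - t.card : ℝ) : ℂ) * Q' y +
            ∑ k ∈ t, Q' (y ∘ Equiv.swap 0 k.succ)) :=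
          (hQ'm.const_mul _).add (IsMultiaffine.sum fun l _ => hQ'm.comp_equiv _)
        have h1 := hP.add_swap_ne_zero iht (p := n - t.card) (q := 1) (by linarith) zero_le_one
          (by linarith) (Fin.succ_ne_zero k).symm y hy
        have h2 : ∀ l ∈ t, Q' ((y ∘ Equiv.swap 0 k.succ) ∘ Equiv.swap 0 l.succ) =
            Q' (y ∘ Equiv.swap 0 l.succ) := by
          intro l hl
          have hkl : k.succ ≠ l.succ := fun h => hk (Fin.succ_injective _ h ▸ hl)
          have hmul : Equiv.swap 0 k.succ * Equiv.swap 0 l.succ =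
              Equiv.swap 0 l.succ * Equiv.swap k.succ l.succ := by
            rw [Equiv.mul_swap_eq_swap_mul (Equiv.swap 0 l.succ) k.succ l.succ,
              Equiv.swap_apply_right, Equiv.swap_apply_of_ne_of_ne (Fin.succ_ne_zero k) hkl,
              Equiv.swap_comm k.succ]
          rw [← hinv k l (y ∘ Equiv.swap 0 l.succ), Function.comp_assoc, Function.comp_assoc,
            ← Equiv.Perm.coe_mul, ← Equiv.Perm.coe_mul, hmul]
        rw [Finset.sum_congr rfl h2] at h1
        rw [Finset.sum_insert hk, Finset.card_insert_of_notMem hk]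
        intro h0
        refine h1 ?_
        push_cast at h0 ⊢
        linear_combination (n + 1 - t.card : ℂ) * h0
    have hfin := key Finset.univ y hy
    rw [← Equiv.sum_comp Equiv.Perm.decomposeFin.symm, Fintype.sum_prod_type, Fin.sum_univ_succ]
    convert hfin using 2
    · simp [hQ']
    · refine Finset.sum_congr rfl fun k _ => Finset.sum_congr rfl fun π _ => ?_
      rw [swap_mul_decomposeFin_symm, Equiv.Perm.coe_mul]
      rfl

end Stability

namespace OrientedGraph

/-! ### Stability of the sum over all coverings. -/

section RealRooted

variable {V E : Type*} [DecidableEq V] [DecidableEq E]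

theorem matchingSum_congr_graph {R : Type*} [CommRing R] {G H : OrientedGraph V E}
    (hG : G.Loopless) (hH : H.Loopless) (A : Finset E)
    (h : ∀ e ∈ A, G.head e = H.head e ∧ G.tail e = H.tail e) (S : Finset V) (x : V → R) :
    G.matchingSum A S x = H.matchingSum A S x := by
  induction A using Finset.induction_on generalizing S with
  | empty => rw [matchingSum_empty, matchingSum_empty]
  | insert e A he ih =>
    have ih' := ih fun f hf => h f (Finset.mem_insert_of_mem hf)
    have hee := h e (Finset.mem_insert_self _ _)
    rw [G.matchingSum_insert he (hG e), H.matchingSum_insert he (hH e), ih', ih', hee.1, hee.2]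

theorem matchingSum_update_add {R : Type*} [CommRing R] (G : OrientedGraph V E)
    (hG : G.Loopless) (A : Finset E) {S : Finset V} {w : V} (hw : w ∈ S) (x : V → R) (s : R) :
    G.matchingSum A S (Function.update x w (x w + s)) =
      G.matchingSum A S x + s * G.matchingSum A (S.erase w) x := by
  rw [G.matchingSum_eq_add hG A S hw (Function.update x w (x w + s)),
    G.matchingSum_eq_add hG A S hw x, Function.update_idem, Function.update_self,
    G.matchingSum_congr A (y := x) (S := S.erase w)
      fun u hu => Function.update_of_ne (Finset.ne_of_mem_erase hu) _ _]
  ring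

variable [Fintype V] [Fintype E]

/-- The sum, over all labelings, of the multivariate matching polynomials of the coverings of the
subgraph with edge set `A`. -/
noncomputable def coveringMatchingSum (G : OrientedGraph V E) (d : ℕ) (A : Finset E)
    (x : V × Fin d → ℂ) : ℂ :=
  ∑ σ : E → Equiv.Perm (Fin d),
    (G.covering d σ).matchingSum (A ×ˢ Finset.univ) Finset.univ x

/-- The point `x` shifted by `y` on the fibre of the head of `e`, and by `z` on the fibre of its
tail, the latter being identified with the former through `π`. -/
def shift (G : OrientedGraph V E) {d : ℕ} (e : E) (π : Equiv.Perm (Fin d)) (x : V × Fin d → ℂ)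
    (y z : Fin d → ℂ) : V × Fin d → ℂ := fun w =>
  x w + (if w.1 = G.head e then y w.2 else 0) + (if w.1 = G.tail e then z (π.symm w.2) else 0)

omit [DecidableEq E] [Fintype V] [Fintype E] in
theorem shift_im_pos {G : OrientedGraph V E} (hG : G.Loopless) {d : ℕ} (e : E)
    (π : Equiv.Perm (Fin d)) {ε : ℝ} (hε : 0 < ε) {x : V × Fin d → ℂ} (hx : ∀ w, ε ≤ (x w).im)
    {y z : Fin d → ℂ} (hy : ∀ i, -ε < (y i).im) (hz : ∀ i, -ε < (z i).im) (w : V × Fin d) :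
    0 < (G.shift e π x y z w).im := by
  have h1 := hx w
  unfold shift
  by_cases hh : w.1 = G.head e
  · have ht : w.1 ≠ G.tail e := fun h => hG e (hh.symm.trans h)
    rw [if_pos hh, if_neg ht, add_zero, Complex.add_im]
    linarith [hy w.2]
  · rw [if_neg hh, add_zero, Complex.add_im]
    split_ifs
    · linarith [hz (π.symm w.2)]
    · simp only [Complex.zero_im]; linarith

omit [DecidableEq E] [Fintype V] [Fintype E] in
theorem shift_update_head {G : OrientedGraph V E} (hG : G.Loopless) {d : ℕ} (e : E)
    (π : Equiv.Perm (Fin d)) (x : V × Fin d → ℂ) (y z : Fin d → ℂ) (i : Fin d) (s : ℂ) :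
    G.shift e π x (Function.update y i (y i + s)) z =
      Function.update (G.shift e π x y z) (G.head e, i) (G.shift e π x y z (G.head e, i) + s) := by
  ext ⟨v, j⟩
  by_cases hv : v = G.head e
  · subst hv
    by_cases hj : j = i
    · subst hj
      simp [shift, hG e]
      ring
    · simp [shift, hG e, hj]
  · simp [shift, hv]

omit [DecidableEq E] [Fintype V] [Fintype E] in
theorem shift_update_tail {G : OrientedGraph V E} (hG : G.Loopless) {d : ℕ} (e : E)
    (π : Equiv.Perm (Fin d)) (x : V × Fin d → ℂ) (y z : Fin d → ℂ) (i : Fin d) (s : ℂ) :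
    G.shift e π x y (Function.update z i (z i + s)) =
      Function.update (G.shift e π x y z) (G.tail e, π i)
        (G.shift e π x y z (G.tail e, π i) + s) := by
  ext ⟨v, j⟩
  by_cases hv : v = G.tail e
  · subst hv
    by_cases hj : j = π i
    · subst hj
      simp [shift, (hG e).symm]
      ring
    · have hj' : π.symm j ≠ i := fun h => hj (by rw [← h]; simp)
      simp [shift, hj, Function.update_of_ne hj']
  · simp [shift, hv]

/-- The intermediate sums when the edge `e` is added to `A`: only the part over `D` of the fibre
of `e` is present. -/
noncomputable def partialMatchingSum (G : OrientedGraph V E) (d : ℕ) (A : Finset E) (e : E)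
    (D : Finset (Fin d)) (x : V × Fin d → ℂ) (y z : Fin d → ℂ) : ℂ :=
  ∑ σ : E → Equiv.Perm (Fin d), (G.covering d σ).matchingSum (A ×ˢ Finset.univ ∪ {e} ×ˢ D)
    Finset.univ (G.shift e (σ e) x y z)

/-- With no lift of `e` present, `σ e` enters only by permuting `z`. Translating `σ e` by any `π`
leaves the sum unchanged, so its vanishing would force that of the full symmetrization in `z` of a
nonvanishing multiaffine function. -/
theorem partialMatchingSum_empty_ne_zero {G : OrientedGraph V E} (hG : G.Loopless) {d : ℕ}
    {A : Finset E} {e : E} (he : e ∉ A)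
    (hA : ∀ x, (∀ w, 0 < (x w).im) → G.coveringMatchingSum d A x ≠ 0)
    {ε : ℝ} (hε : 0 < ε) {x : V × Fin d → ℂ} (hx : ∀ w, ε ≤ (x w).im)
    {y z : Fin d → ℂ} (hy : ∀ i, -ε < (y i).im) (hz : ∀ i, -ε < (z i).im) :
    G.partialMatchingSum d A e ∅ x y z ≠ 0 := by
  set M : (E → Equiv.Perm (Fin d)) → (Fin d → ℂ) → ℂ := fun σ z =>
    (G.covering d σ).matchingSum (A ×ˢ Finset.univ) Finset.univ (G.shift e 1 x y z) with hM
  have hmulti : IsMultiaffine fun z => ∑ σ, M σ z := by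
    refine IsMultiaffine.sum fun σ _ z i => ?_
    refine ⟨M σ (Function.update z i 0), (G.covering d σ).matchingSum (A ×ˢ Finset.univ)
      (Finset.univ.erase (G.tail e, (1 : Equiv.Perm (Fin d)) i))
      (G.shift e 1 x y (Function.update z i 0)), fun s => ?_⟩
    have h1 : Function.update z i s =
        Function.update (Function.update z i 0) i (Function.update z i 0 i + s) := by
      rw [Function.update_idem, Function.update_self, zero_add]
    rw [hM]
    dsimp only
    rw [h1, shift_update_tail hG,
      (G.covering d σ).matchingSum_update_add (loopless_covering hG d σ) _ (Finset.mem_univ _),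
      mul_comm]
  have hsym := hmulti.sum_perm_ne_zero (η := -ε)
    (fun z hz => hA _ (shift_im_pos hG e 1 hε hx hy hz)) z hz
  have hMσ : ∀ (π : Equiv.Perm (Fin d)) σ z, M (Pi.mulSingle e π * σ) z = M σ z := by
    intro π σ z
    refine matchingSum_congr_graph (loopless_covering hG d _) (loopless_covering hG d σ) _ ?_ _ _
    intro f hf
    have hfe : f.1 ≠ e := fun h => he (h ▸ (Finset.mem_product.1 hf).1)
    exact ⟨rfl, by simp [covering, hfe]⟩
  have hP : ∀ π : Equiv.Perm (Fin d), G.partialMatchingSum d A e ∅ x y z =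
      ∑ σ, M σ (z ∘ ((σ e)⁻¹ * π⁻¹ : Equiv.Perm (Fin d))) := by
    intro π
    rw [partialMatchingSum,
      ← Equiv.sum_comp (Equiv.mulLeft (Pi.mulSingle e π : E → Equiv.Perm (Fin d)))]
    refine Finset.sum_congr rfl fun σ _ => ?_
    have hinv : ((σ e)⁻¹ * π⁻¹ : Equiv.Perm (Fin d)) =
        ((Pi.mulSingle e π * σ : E → Equiv.Perm (Fin d)) e).symm := by
      rw [Pi.mul_apply, Pi.mulSingle_eq_same, ← mul_inv_rev]
      rfl
    rw [← hMσ π σ, hinv, Finset.product_empty, Finset.union_empty]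
    rfl
  intro h0
  refine hsym ?_
  rw [Finset.sum_comm]
  have : ∀ σ, ∑ π : Equiv.Perm (Fin d), M σ (z ∘ π) =
      ∑ π : Equiv.Perm (Fin d), M σ (z ∘ ((σ e)⁻¹ * π⁻¹ : Equiv.Perm (Fin d))) := fun σ =>
    (Equiv.sum_comp ((Equiv.inv _).trans (Equiv.mulLeft (σ e)⁻¹)) fun π => M σ (z ∘ π)).symm
  rw [Finset.sum_congr rfl fun σ _ => this σ, Finset.sum_comm]
  exact Finset.sum_eq_zero fun π _ => by rw [← hP π, h0]

/-- The sum for `D` is biaffine in the shifts `y i`, `z i`. Adding the lift of `e` over `i`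
subtracts its mixed coefficient from its constant one, which is where
`sub_ne_zero_of_biaffine_ne_zero` applies. The shifts over `D` have been used up and are zero. -/
theorem partialMatchingSum_ne_zero {G : OrientedGraph V E} (hG : G.Loopless) {d : ℕ}
    {A : Finset E} {e : E} (he : e ∉ A)
    (hA : ∀ x, (∀ w, 0 < (x w).im) → G.coveringMatchingSum d A x ≠ 0)
    {ε : ℝ} (hε : 0 < ε) {x : V × Fin d → ℂ} (hx : ∀ w, ε ≤ (x w).im) (D : Finset (Fin d))
    {y z : Fin d → ℂ} (hy : ∀ i, -ε < (y i).im) (hz : ∀ i, -ε < (z i).im)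
    (hyD : ∀ i ∈ D, y i = 0) (hzD : ∀ i ∈ D, z i = 0) :
    G.partialMatchingSum d A e D x y z ≠ 0 := by
  induction D using Finset.induction_on generalizing y z with
  | empty => exact partialMatchingSum_empty_ne_zero hG he hA hε hx hy hz
  | insert i D hi ih =>
    have hyi := hyD i (Finset.mem_insert_self _ _)
    have hzi := hzD i (Finset.mem_insert_self _ _)
    set H := fun σ => G.covering d σ with hH
    have hHl : ∀ σ, (H σ).Loopless := loopless_covering hG d
    set B := A ×ˢ (Finset.univ : Finset (Fin d)) ∪ {e} ×ˢ D with hB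
    have hBi : (e, i) ∉ B := by simp [hB, he, hi]
    have hBins : A ×ˢ (Finset.univ : Finset (Fin d)) ∪ {e} ×ˢ (insert i D) = insert (e, i) B := by
      ext ⟨f, j⟩
      simp only [hB, Finset.mem_union, Finset.mem_product, Finset.mem_insert, Finset.mem_univ,
        Finset.mem_singleton, Prod.mk.injEq]
      tauto
    set X := fun σ : E → Equiv.Perm (Fin d) => G.shift e (σ e) x y z with hX
    have hexp : ∀ s t, G.partialMatchingSum d A e D x (Function.update y i (y i + s))
        (Function.update z i (z i + t)) =
        (∑ σ, (H σ).matchingSum B Finset.univ (X σ)) +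
        (∑ σ, (H σ).matchingSum B (Finset.univ.erase (G.head e, i)) (X σ)) * s +
        (∑ σ, (H σ).matchingSum B (Finset.univ.erase (G.tail e, σ e i)) (X σ)) * t +
        (∑ σ, (H σ).matchingSum B ((Finset.univ.erase (G.head e, i)).erase (G.tail e, σ e i))
          (X σ)) * (s * t) := by
      intro s t
      rw [partialMatchingSum, Finset.sum_mul, Finset.sum_mul, Finset.sum_mul,
        ← Finset.sum_add_distrib, ← Finset.sum_add_distrib, ← Finset.sum_add_distrib]
      refine Finset.sum_congr rfl fun σ _ => ?_
      have hne : (G.tail e, σ e i) ≠ (G.head e, i) := fun h => hG e (congrArg Prod.fst h).symm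
      rw [shift_update_tail hG, (H σ).matchingSum_update_add (hHl σ) _ (Finset.mem_univ _),
        shift_update_head hG, (H σ).matchingSum_update_add (hHl σ) _ (Finset.mem_univ _),
        (H σ).matchingSum_update_add (hHl σ) _
          (Finset.mem_erase.2 ⟨hne.symm, Finset.mem_univ _⟩), Finset.erase_right_comm]
      ring
    have hfin : G.partialMatchingSum d A e (insert i D) x y z =
        (∑ σ, (H σ).matchingSum B Finset.univ (X σ)) -
        (∑ σ, (H σ).matchingSum B ((Finset.univ.erase (G.head e, i)).erase (G.tail e, σ e i))
          (X σ)) := by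
      rw [partialMatchingSum, hBins, ← Finset.sum_sub_distrib]
      refine Finset.sum_congr rfl fun σ _ => ?_
      rw [(G.covering d σ).matchingSum_insert hBi (hHl σ _), if_pos ⟨Finset.mem_univ _, Finset.mem_univ _⟩]
      rfl
    rw [hfin]
    refine sub_ne_zero_of_biaffine_ne_zero hε
      (b := ∑ σ, (H σ).matchingSum B (Finset.univ.erase (G.head e, i)) (X σ))
      (c := ∑ σ, (H σ).matchingSum B (Finset.univ.erase (G.tail e, σ e i)) (X σ))
      fun s t hs ht => ?_
    rw [← hexp]
    refine ih ?_ ?_ ?_ ?_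
    · intro j
      by_cases hj : j = i
      · subst hj; simpa [hyi]
      · simpa [hj] using hy j
    · intro j
      by_cases hj : j = i
      · subst hj; simpa [hzi]
      · simpa [hj] using hz j
    · intro j hj
      rw [Function.update_of_ne (ne_of_mem_of_not_mem hj hi), hyD j (Finset.mem_insert_of_mem hj)]
    · intro j hj
      rw [Function.update_of_ne (ne_of_mem_of_not_mem hj hi), hzD j (Finset.mem_insert_of_mem hj)]

theorem coveringMatchingSum_ne_zero {G : OrientedGraph V E} (hG : G.Loopless) (d : ℕ)
    (A : Finset E) {x : V × Fin d → ℂ} (hx : ∀ w, 0 < (x w).im) :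
    G.coveringMatchingSum d A x ≠ 0 := by
  induction A using Finset.induction_on generalizing x with
  | empty =>
    have hne : ∏ w, x w ≠ 0 := Finset.prod_ne_zero_iff.2 fun w _ h => by
      have := hx w
      simp [h] at this
    simp only [coveringMatchingSum, Finset.empty_product, matchingSum_empty, Finset.sum_const,
      nsmul_eq_mul]
    exact mul_ne_zero (Nat.cast_ne_zero.2 Fintype.card_ne_zero) hne
  | insert e A he ih =>
    -- This margin lets the shifts range over a half-plane containing the origin in its interior.
    obtain ⟨ε, hε, hxε⟩ : ∃ ε : ℝ, 0 < ε ∧ ∀ w, ε ≤ (x w).im := by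
      cases isEmpty_or_nonempty (V × Fin d) with
      | inl h => exact ⟨1, one_pos, fun w => h.elim w⟩
      | inr h =>
        obtain ⟨w, hw⟩ := Finite.exists_min fun w => (x w).im
        exact ⟨_, hx w, hw⟩
    have h := partialMatchingSum_ne_zero hG he (fun x hx => ih hx) hε hxε Finset.univ (y := 0)
      (z := 0) (by simp [hε]) (by simp [hε]) (by simp) (by simp)
    have hs : ∀ π, G.shift e π x 0 0 = x := fun π => by ext w; simp [shift]
    have hset : insert e A ×ˢ (Finset.univ : Finset (Fin d)) =
        A ×ˢ Finset.univ ∪ {e} ×ˢ Finset.univ := by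
      rw [Finset.insert_eq, Finset.union_product, Finset.union_comm]
    simp only [partialMatchingSum, hs] at h
    rwa [coveringMatchingSum, hset]

theorem aeval_dMatchingPoly_ne_zero {G : OrientedGraph V E} (hG : G.Loopless) (d : ℕ) {z : ℂ}
    (hz : z.im ≠ 0) : aeval z (G.dMatchingPoly d) ≠ 0 := by
  wlog hpos : 0 < z.im generalizing z
  · have h := this (z := (starRingEnd ℂ) z) (by simpa using hz)
      (by rw [Complex.conj_im]; rcases hz.lt_or_gt with h | h; linarith; exact absurd h hpos)
    rw [aeval_conj] at h
    exact fun h0 => h (by rw [h0, map_zero])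
  obtain ⟨c, hc, h⟩ := G.exists_dMatchingPoly_eq d
  rw [h, map_mul, aeval_C, map_sum]
  refine mul_ne_zero (by simpa using hc) ?_
  simp only [aeval_matchingPoly]
  exact coveringMatchingSum_ne_zero hG d Finset.univ (x := fun _ => z) fun _ => hpos

theorem splits_dMatchingPoly {G : OrientedGraph V E} (hG : G.Loopless) (d : ℕ) :
    (G.dMatchingPoly d).Splits := by
  refine Splits.of_splits_map (algebraMap ℝ ℂ) (IsAlgClosed.splits _) fun z hz => ?_
  have h0 : aeval z (G.dMatchingPoly d) = 0 := by
    rw [aeval_def, ← eval_map]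
    exact isRoot_of_mem_roots hz
  have him : z.im = 0 := by
    by_contra him
    exact aeval_dMatchingPoly_ne_zero hG d him h0
  exact ⟨z.re, Complex.ext rfl him.symm⟩

end RealRooted

end OrientedGraph

theorem mainTheorem5 {V E : Type*} [Fintype V] [Fintype E] (G : OrientedGraph V E)
    (hG : G.Loopless) (d : ℕ) (hd : 1 ≤ d) :
    (G.dMatchingPoly d).Splits ∧
      (G.Connected → ∀ v : V, ∀ x : ℝ, (G.dMatchingPoly d).IsRoot x →
        x ∈ Set.Icc (-(G.rho v)) (G.rho v)) ∧
      (∀ x : ℝ, (G.dMatchingPoly d).IsRoot x →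
        ∃ v : V, x ∈ Set.Icc (-(G.rho v)) (G.rho v)) := by
  classical
  refine ⟨G.splits_dMatchingPoly hG d, fun hc v x hx => ?_, fun x hx => ?_⟩
  · rw [Set.mem_Icc, ← abs_le]
    by_contra! hlt
    refine G.dMatchingPoly_eval_ne_zero_of_rho_lt hG d (fun u => ?_) hx
    obtain ⟨l, hl, hu⟩ := G.exists_isReducedWalk_of_connected hc v u
    exact ⟨v, l, hl, hu, hlt⟩
  · by_contra! h
    -- The empty walk makes each vertex its own base point.
    refine G.dMatchingPoly_eval_ne_zero_of_rho_lt hG d (fun u => ⟨u, [], trivial, rfl, ?_⟩) hx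
    by_contra! hle
    exact h u (abs_le.1 hle)
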